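/- Let $1\le k\le m_1$ and $1\le q\le m_2$ be integers, and equip $\mathbb R^{m_1\times m_2}$ with the inner product $\langle A,B\rangle=\operatorname{tr}(A^\top B)$. For a norm $N$ on $\mathbb R^{m_1\times m_2}$ let $N^*(X)=\sup\{\langle X,Z\rangle : N(Z)\le 1\}$ be its dual norm. Let $\mathcal A^n_j=\{a\in\mathbb R^n : \|a\|_0\le j,\ \|a\|_2=1\}$, where $\|a\|_0$ is the number of nonzero coordinates of $a$, let $\mathcal A_{k,q}=\{ab^\top : a\in\mathcal A^{m_1}_k,\ b\in\mathcal A^{m_2}_q\}$, and let the $(k,q)$-trace norm be $$\Omega_{k,q}(Z)=\inf\{t>0 : Z\in t\,\mathrm{conv}(\mathcal A_{k,q})\}.$$ Let $\|Z\|_1=\sum_{i,j}|Z_{ij}|$ be the entrywise $\ell_1$ norm and $\|Z\|_{\mathrm{tr}}$ the trace norm (the sum of the singular values). Let $\|Z\|_\infty=\max_{i,j}|Z_{ij}|$ be the entrywise maximum norm and $\|Z\|_{\mathrm{op}}$ the operator norm (the largest singular value); these are the dual norms of $\|\cdot\|_1$ and $\|\cdot\|_{\mathrm{tr}}$, respectively.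 Let $G\in\mathbb R^{m_1\times m_2}$ be a random matrix with i.i.d. $\mathcal N(0,1)$ entries. Then the random variables $\Omega_{k,q}^*(G)$, $\|G\|_1^*$, $\|G\|_\infty$, $\|G\|_{\mathrm{tr}}^*$ and $\|G\|_{\mathrm{op}}$ are integrable, and $$\mathbb E\,\Omega_{k,q}^*(G)\le 4\left(\sqrt{k\log\tfrac{m_1}{k}+2k}+\sqrt{q\log\tfrac{m_2}{q}+2q}\right),$$ $$\mathbb E\,\|G\|_1^*\le\sqrt{2\log(m_1m_2)}\quad\text{and}\quad\mathbb E\,\|G\|_\infty\le\sqrt{2\log(m_1m_2)}\quad\text{provided } m_1m_2\ge 2,$$ $$\mathbb E\,\|G\|_{\mathrm{tr}}^*\le\sqrt{m_1}+\sqrt{m_2}\quad\text{and}\quad\mathbb E\,\|G\|_{\mathrm{op}}\le\sqrt{m_1}+\sqrt{m_2}.$$ -/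

import Mathlib

open MeasureTheory ProbabilityTheory
open scoped Pointwise

noncomputable section

/-- The standard inner product `tr (Aᵀ B)` on real matrices. -/
def matInner {m₁ m₂ : ℕ} (A B : Matrix (Fin m₁) (Fin m₂) ℝ) : ℝ :=
  (A.transpose * B).trace

/-- The dual norm of `N`: `sup { ⟨X, Z⟩ : N Z ≤ 1 }`. -/
def dualNorm {m₁ m₂ : ℕ} (N : Matrix (Fin m₁) (Fin m₂) ℝ → ℝ)
    (X : Matrix (Fin m₁) (Fin m₂) ℝ) : ℝ :=
  sSup {r : ℝ | ∃ Z, N Z ≤ 1 ∧ r = matInner X Z}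

/-- Unit vectors of Euclidean `ℝⁿ` with at most `j` nonzero coordinates. -/
def sparseUnitVectors (n j : ℕ) : Set (EuclideanSpace ℝ (Fin n)) :=
  {a | {i | a i ≠ 0}.ncard ≤ j ∧ ‖a‖ = 1}

/-- The atoms `a bᵀ` with `a` a `k`-sparse and `b` a `q`-sparse unit vector. -/
def kqAtoms (m₁ m₂ k q : ℕ) : Set (Matrix (Fin m₁) (Fin m₂) ℝ) :=
  {A | ∃ a ∈ sparseUnitVectors m₁ k, ∃ b ∈ sparseUnitVectors m₂ q,
    A = Matrix.of fun i j => a i * b j}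

/-- The `(k,q)`-trace norm: the gauge `inf { t > 0 : Z ∈ t • conv 𝒜 }` of the convex hull of
the set `𝒜` of atoms. -/
def kqTraceNorm {m₁ m₂ : ℕ} (k q : ℕ) (Z : Matrix (Fin m₁) (Fin m₂) ℝ) : ℝ :=
  gauge (convexHull ℝ (kqAtoms m₁ m₂ k q)) Z

/-- The entrywise `ℓ₁` norm. -/
def entryL1Norm {m₁ m₂ : ℕ} (Z : Matrix (Fin m₁) (Fin m₂) ℝ) : ℝ :=
  ∑ i, ∑ j, |Z i j|

/-- The entrywise `ℓ_∞` norm. -/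
def entryMaxNorm {m₁ m₂ : ℕ} (Z : Matrix (Fin m₁) (Fin m₂) ℝ) : ℝ :=
  ⨆ p : Fin m₁ × Fin m₂, |Z p.1 p.2|

/-- The trace norm: the sum of the singular values (the `i`-th singular value is `0` for
`i ≥ m₂`). -/
def traceNorm {m₁ m₂ : ℕ} (Z : Matrix (Fin m₁) (Fin m₂) ℝ) : ℝ :=
  ∑ i : Fin m₂, (Matrix.toEuclideanLin Z).singularValues i

/-- The operator norm with respect to the Euclidean norms. -/
def opNorm {m₁ m₂ : ℕ} (Z : Matrix (Fin m₁) (Fin m₂) ℝ) : ℝ :=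
  ‖(Matrix.toEuclideanLin Z).toContinuousLinearMap‖

/-! The supremum in `dualNorm` is over a set that is bounded above for each of the three norms,
so that it is a genuine supremum of real numbers. -/

theorem matInner_eq {m₁ m₂ : ℕ} (A B : Matrix (Fin m₁) (Fin m₂) ℝ) :
    matInner A B = ∑ i, ∑ j, A i j * B i j := by
  rw [matInner, Matrix.trace, Finset.sum_comm]
  simp [Matrix.mul_apply]

theorem bddAbove_of_entry_le {m₁ m₂ : ℕ} (N : Matrix (Fin m₁) (Fin m₂) ℝ → ℝ) (C : ℝ)
    (hN : ∀ Z, N Z ≤ 1 → ∀ i j, |Z i j| ≤ C) (X : Matrix (Fin m₁) (Fin m₂) ℝ) :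
    BddAbove {r : ℝ | ∃ Z, N Z ≤ 1 ∧ r = matInner X Z} := by
  refine ⟨∑ i, ∑ j, |X i j| * C, ?_⟩
  rintro r ⟨Z, hZ, rfl⟩
  rw [matInner_eq]
  refine Finset.sum_le_sum fun i _ => Finset.sum_le_sum fun j _ => ?_
  calc X i j * Z i j ≤ |X i j * Z i j| := le_abs_self _
    _ = |X i j| * |Z i j| := abs_mul _ _
    _ ≤ |X i j| * C := mul_le_mul_of_nonneg_left (hN Z hZ i j) (abs_nonneg _)

theorem bddAbove_dual_entryL1Norm {m₁ m₂ : ℕ} (X : Matrix (Fin m₁) (Fin m₂) ℝ) :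
    BddAbove {r : ℝ | ∃ Z, entryL1Norm Z ≤ 1 ∧ r = matInner X Z} := by
  refine bddAbove_of_entry_le _ 1 (fun Z hZ i j => le_trans ?_ hZ) X
  calc |Z i j| ≤ ∑ j, |Z i j| :=
        Finset.single_le_sum (f := fun j => |Z i j|) (fun _ _ => abs_nonneg _)
          (Finset.mem_univ j)
    _ ≤ entryL1Norm Z :=
        Finset.single_le_sum (f := fun i => ∑ j, |Z i j|)
          (fun _ _ => Finset.sum_nonneg fun _ _ => abs_nonneg _) (Finset.mem_univ i)

theorem abs_entry_le_traceNorm {m₁ m₂ : ℕ} (Z : Matrix (Fin m₁) (Fin m₂) ℝ)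
    (i : Fin m₁) (j : Fin m₂) : |Z i j| ≤ traceNorm Z := by
  set T := Matrix.toEuclideanLin Z with hT
  have hn : Module.finrank ℝ (EuclideanSpace ℝ (Fin m₂)) = m₂ := by simp
  set b := T.isSymmetric_adjoint_comp_self.eigenvectorBasis hn with hb
  have hnorm : ∀ l, ‖T (b l)‖ = T.singularValues l := by
    intro l
    have h1 : ‖T (b l)‖ ^ 2 = T.singularValues l ^ 2 := by
      rw [T.sq_singularValues_fin hn l, ← real_inner_self_eq_norm_sq,
        ← LinearMap.adjoint_inner_left]
      have := T.isSymmetric_adjoint_comp_self.apply_eigenvectorBasis hn l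
      rw [LinearMap.comp_apply] at this
      rw [hb, this, inner_smul_left, real_inner_self_eq_norm_sq]
      simp
    exact (sq_eq_sq₀ (norm_nonneg _) (T.singularValues_nonneg _)).1 h1
  set e : EuclideanSpace ℝ (Fin m₂) := EuclideanSpace.single j 1 with he
  have hZ : T e i = Z i j := by
    simp [hT, he, Matrix.toLpLin_apply]
  calc |Z i j| = ‖T e i‖ := by rw [hZ, Real.norm_eq_abs]
    _ ≤ ‖T e‖ := PiLp.norm_apply_le _ _
    _ = ‖∑ l, inner ℝ (b l) e • T (b l)‖ := by
        conv_lhs => rw [← b.sum_repr' e]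
        simp
    _ ≤ ∑ l, ‖inner ℝ (b l) e • T (b l)‖ := norm_sum_le _ _
    _ ≤ ∑ l : Fin m₂, T.singularValues l := by
        refine Finset.sum_le_sum fun l _ => ?_
        rw [norm_smul, hnorm]
        refine mul_le_of_le_one_left (T.singularValues_nonneg _) ?_
        refine (norm_inner_le_norm _ _).trans ?_
        simp [he]

theorem bddAbove_dual_traceNorm {m₁ m₂ : ℕ} (X : Matrix (Fin m₁) (Fin m₂) ℝ) :
    BddAbove {r : ℝ | ∃ Z, traceNorm Z ≤ 1 ∧ r = matInner X Z} :=
  bddAbove_of_entry_le _ 1 (fun Z hZ i j => (abs_entry_le_traceNorm Z i j).trans hZ) X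

theorem absorbent_convexHull_kqAtoms {m₁ m₂ k q : ℕ} (hk : 1 ≤ k) (hkm : k ≤ m₁)
    (hq : 1 ≤ q) (hqm : q ≤ m₂) (Z : Matrix (Fin m₁) (Fin m₂) ℝ) :
    {r : ℝ | 0 < r ∧ Z ∈ r • convexHull ℝ (kqAtoms m₁ m₂ k q)}.Nonempty := by
  have hE : ∀ i j, ∀ s : ℝ, |s| = 1 →
      Matrix.single i j s ∈ convexHull ℝ (kqAtoms m₁ m₂ k q) := by
    intro i j s hs
    refine subset_convexHull ℝ _ ?_
    refine ⟨EuclideanSpace.single i s, ⟨?_, by simp [hs]⟩,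
      EuclideanSpace.single j 1, ⟨?_, by simp⟩, ?_⟩
    · refine le_trans (Set.ncard_le_ncard (t := {i}) ?_) (by simpa using hk)
      intro x hx
      by_contra h
      simp_all
    · refine le_trans (Set.ncard_le_ncard (t := {j}) ?_) (by simpa using hq)
      intro x hx
      by_contra h
      simp_all
    · ext x y
      simp only [Matrix.single_apply, Matrix.of_apply, PiLp.single_apply]
      by_cases h1 : i = x <;> by_cases h2 : j = y <;>
        simp_all [eq_comm]
  have h0 : (0 : Matrix (Fin m₁) (Fin m₂) ℝ) ∈ convexHull ℝ (kqAtoms m₁ m₂ k q) := by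
    have h1 := hE ⟨0, by omega⟩ ⟨0, by omega⟩ 1 (by simp)
    have h2 := hE ⟨0, by omega⟩ ⟨0, by omega⟩ (-1) (by simp)
    have h3 := (convex_convexHull ℝ (kqAtoms m₁ m₂ k q)) h1 h2
      (a := 1 / 2) (b := 1 / 2) (by norm_num) (by norm_num) (by norm_num)
    have h4 : (1 / 2 : ℝ) • Matrix.single (⟨0, by omega⟩ : Fin m₁) (⟨0, by omega⟩ : Fin m₂) (1 : ℝ)
        + (1 / 2 : ℝ) • Matrix.single ⟨0, by omega⟩ ⟨0, by omega⟩ (-1 : ℝ) = 0 := by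
      ext x y
      simp only [Matrix.add_apply, Matrix.smul_apply, Matrix.single_apply, Matrix.zero_apply]
      split_ifs <;> norm_num
    rwa [h4] at h3
  set R : ℝ := 1 + ∑ p : Fin m₁ × Fin m₂, |Z p.1 p.2| with hR
  have hRpos : 0 < R := by positivity
  refine ⟨R, hRpos, ?_⟩
  rw [Set.mem_smul_set_iff_inv_smul_mem₀ hRpos.ne']
  have hsum := (convex_convexHull ℝ (kqAtoms m₁ m₂ k q)).sum_mem
    (t := (Finset.univ : Finset (Option (Fin m₁ × Fin m₂))))
    (w := fun o => o.elim R⁻¹ fun p => R⁻¹ * |Z p.1 p.2|)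
    (z := fun o => o.elim 0 fun p => Matrix.single p.1 p.2 (if Z p.1 p.2 < 0 then -1 else 1))
    (by rintro (_ | p) _ <;> simp <;> positivity)
    (by
      rw [Fintype.sum_option]
      simp only [Option.elim, ← Finset.mul_sum]
      rw [← mul_one_add, ← hR]
      exact inv_mul_cancel₀ hRpos.ne')
    (by
      rintro (_ | p) _
      · exact h0
      · exact hE _ _ _ (by split_ifs <;> simp))
  convert hsum using 1
  rw [Fintype.sum_option]
  simp only [Option.elim, smul_zero, zero_add, Matrix.smul_single, smul_eq_mul]
  rw [Fintype.sum_prod_type]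
  conv_lhs => rw [Matrix.matrix_eq_sum_single Z]
  simp only [Finset.smul_sum, Matrix.smul_single, smul_eq_mul]
  refine Finset.sum_congr rfl fun i _ => Finset.sum_congr rfl fun j _ => ?_
  congr 1
  rw [mul_assoc]
  congr 1
  split_ifs with h
  · rw [abs_of_neg h]; ring
  · rw [abs_of_nonneg (not_lt.1 h)]; ring

theorem bddAbove_dual_kqTraceNorm {m₁ m₂ k q : ℕ} (hk : 1 ≤ k) (hkm : k ≤ m₁)
    (hq : 1 ≤ q) (hqm : q ≤ m₂) (X : Matrix (Fin m₁) (Fin m₂) ℝ) :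
    BddAbove {r : ℝ | ∃ Z, kqTraceNorm k q Z ≤ 1 ∧ r = matInner X Z} := by
  refine bddAbove_of_entry_le _ 2 (fun Z hZ i j => ?_) X
  obtain ⟨r, ⟨hr0, hr⟩, hr2⟩ := exists_lt_of_csInf_lt
    (absorbent_convexHull_kqAtoms hk hkm hq hqm Z) (lt_of_le_of_lt hZ one_lt_two)
  obtain ⟨Y, hY, rfl⟩ := hr
  have hconv : Convex ℝ {Y : Matrix (Fin m₁) (Fin m₂) ℝ | |Y i j| ≤ 1} := by
    intro A hA B hB s t hs ht hst
    simp only [Set.mem_ofPred_eq, Matrix.add_apply, Matrix.smul_apply, smul_eq_mul] at *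
    calc |s * A i j + t * B i j| ≤ |s * A i j| + |t * B i j| := abs_add_le _ _
      _ = s * |A i j| + t * |B i j| := by
          rw [abs_mul, abs_mul, abs_of_nonneg hs, abs_of_nonneg ht]
      _ ≤ 1 := by nlinarith
  have hY1 : |Y i j| ≤ 1 := by
    refine convexHull_min ?_ hconv hY
    rintro _ ⟨a, ⟨_, ha⟩, b, ⟨_, hb⟩, rfl⟩
    have h1 := PiLp.norm_apply_le a i
    have h2 := PiLp.norm_apply_le b j
    rw [ha, Real.norm_eq_abs] at h1
    rw [hb, Real.norm_eq_abs] at h2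
    simp only [Set.mem_ofPred_eq, Matrix.of_apply, abs_mul]
    exact mul_le_one₀ h1 (abs_nonneg _) h2
  simp only [Matrix.smul_apply, smul_eq_mul, abs_mul, abs_of_pos hr0]
  nlinarith [abs_nonneg (Y i j)]

end

/-!
The Gaussian matrix `G` is the Gaussian process `⟨G, Z⟩`, and each dual norm is the supremum of
this process over the extreme points of a unit ball.

For the operator norm and for the dual of the `(k,q)`-trace norm these points are rank-one
matrices `a bᵀ` with unit vectors `a`, `b`. Chevet's inequality (`chevet`) bounds the expected
supremum of `aᵀ G b` by the sum of the expected suprema of `⟨a, g⟩` and `⟨b, h⟩` for standard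
Gaussian vectors `g` and `h`, with constant one. It rests on the Sudakov–Fernique comparison for
the log-sum-exp function (`integral_logSumExp_le_of_dist_le`): along `cos θ A z + sin θ B z` with
independent `A z` and `B z`, integration by parts turns the derivative of the expectation into a
Gibbs average of differences of squared increments, which are nonnegative. For rank-one matrices
the increments compare because `(1 - ⟨a, a'⟩) (1 - ⟨b, b'⟩) ≥ 0`.

The supremum of `⟨a, g⟩` over all unit vectors is `‖g‖`, of expectation at most `√m₁`. Over
`k`-sparse unit vectors its square is a sum of `k` of the `g i ^ 2`, hence at most
`k t + ∑ (g i ^ 2 - t)⁺`; with `t = 4 log (m₁ / k)` an exponential moment bounds the expectation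
of this sum by `4 (k log (m₁ / k) + 2 k)`. The dual of the trace norm is at most the operator
norm, by evaluating the trace in an eigenbasis of `Zᵀ Z`. All the norms are integrable because
they are Lipschitz functions of the entries (`integrable_of_le_add_sum_abs_sub`).

The dual of the `ℓ₁` norm is at most the entrywise maximum of `N = m₁ m₂` absolute values. For a
level `t`, its expectation is at most `t + N E (|g| - t)⁺`. For `N ≥ 7` a Mills ratio estimate and
`t² = 2 log N - 1.7` give `√(2 log N)`; for `N = 4, 5, 6` the level `6 / 5` does, with a Taylor
estimate of the excess. For `N = 2, 3` no bound of this form is small enough, and the identity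
`max |x| |y| = (|x + y| + |x - y|) / 2` gives the expected pairwise maxima exactly.
-/

/-! ### Standard Gaussian vectors and integration by parts -/

/-- The law of a vector of independent standard Gaussian variables indexed by `J`. -/
noncomputable abbrev gaussianPi (J : Type*) [Fintype J] : Measure (J → ℝ) :=
  Measure.pi fun _ : J => gaussianReal 0 1

theorem measurePreserving_eval_gaussianPi {J : Type*} [Fintype J] (j : J) :
    MeasurePreserving (fun z : J → ℝ => z j) (gaussianPi J) (gaussianReal 0 1) :=
  measurePreserving_eval _ j

theorem hasLaw_comp_gaussianPi {J J' : Type*} [Fintype J] [Fintype J'] {e : J' → J}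
    (he : e.Injective) :
    HasLaw (fun (z : J → ℝ) j => z (e j)) (gaussianPi J') (gaussianPi J) := by
  have h : iIndepFun (fun (j : J) (z : J → ℝ) => z j) (gaussianPi J) :=
    iIndepFun_pi (X := fun _ => id) fun _ => aemeasurable_id
  exact (h.precomp he).hasLaw_pi fun j => (measurePreserving_eval_gaussianPi (e j)).hasLaw

theorem integrable_eval_gaussianPi {J : Type*} [Fintype J] (j : J) :
    Integrable (fun z : J → ℝ => z j) (gaussianPi J) :=
  (measurePreserving_eval_gaussianPi j).integrable_comp_of_integrable
    ((memLp_id_gaussianReal 1).integrable (by simp))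

theorem integral_sq_gaussianReal : ∫ x, x ^ 2 ∂(gaussianReal 0 1) = 1 := by
  have h := variance_fun_id_gaussianReal (μ := 0) (v := 1)
  rw [variance_of_integral_eq_zero (by fun_prop) (by simp)] at h
  simpa using h

theorem integrable_sq_gaussianReal : Integrable (fun x : ℝ => x ^ 2) (gaussianReal 0 1) :=
  (memLp_id_gaussianReal 2).integrable_sq

/-- Resampling one coordinate of a product measure leaves the measure unchanged. -/
theorem measurePreserving_update_pi {J : Type*} [Fintype J] [DecidableEq J] (μ : J → Measure ℝ)
    [∀ j, IsProbabilityMeasure (μ j)] (j : J) :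
    MeasurePreserving (fun p : (J → ℝ) × ℝ => Function.update p.1 j p.2)
      ((Measure.pi μ).prod (μ j)) (Measure.pi μ) := by
  have hm : Measurable (fun p : (J → ℝ) × ℝ => Function.update p.1 j p.2) := by
    refine measurable_pi_lambda _ fun i => ?_
    by_cases h : i = j
    · subst h; simpa using measurable_snd
    · simp only [Function.update_of_ne h]
      exact (measurable_pi_apply i).comp measurable_fst
  refine ⟨hm, (Measure.pi_eq fun s hs => ?_).symm⟩
  rw [Measure.map_apply hm (MeasurableSet.univ_pi hs)]
  have : (fun p : (J → ℝ) × ℝ => Function.update p.1 j p.2) ⁻¹' Set.univ.pi s =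
      (Set.univ.pi (Function.update s j Set.univ)) ×ˢ s j := by
    ext p
    simp only [Set.mem_preimage, Set.mem_pi, Set.mem_univ, forall_const, Set.mem_prod]
    constructor
    · intro h
      refine ⟨fun i => ?_, by simpa using h j⟩
      by_cases hi : i = j
      · subst hi; simp
      · simpa [Function.update_of_ne hi] using h i
    · rintro ⟨h, h'⟩ i
      by_cases hi : i = j
      · subst hi; simpa using h'
      · simpa [Function.update_of_ne hi] using h i
  rw [this, Measure.prod_prod, Measure.pi_pi, ← Finset.prod_erase_mul _ _ (Finset.mem_univ j),
    ← Finset.prod_erase_mul _ (fun i => μ i (s i)) (Finset.mem_univ j)]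
  simp only [Function.update_self, measure_univ, mul_one]
  congr 1
  refine Finset.prod_congr rfl fun i hi => ?_
  rw [Function.update_of_ne (Finset.ne_of_mem_erase hi)]

theorem gaussianPDFReal_zero_one (x : ℝ) :
    gaussianPDFReal 0 1 x = (√(2 * Real.pi))⁻¹ * Real.exp (-x ^ 2 / 2) := by
  simp [gaussianPDFReal]

theorem integrable_of_bounded_of_continuous {α : Type*} [TopologicalSpace α] [MeasurableSpace α]
    [OpensMeasurableSpace α] {μ : Measure α} [IsFiniteMeasure μ] {f : α → ℝ} {C : ℝ}
    [SecondCountableTopologyEither α ℝ] (hf : Continuous f) (hC : ∀ x, |f x| ≤ C) :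
    Integrable f μ :=
  Integrable.of_bound hf.aestronglyMeasurable C (ae_of_all _ hC)

theorem integral_mul_gaussianReal_eq_integral_deriv {f f' : ℝ → ℝ} {C : ℝ}
    (hf : ∀ x, HasDerivAt f (f' x) x) (hf' : Continuous f') (hC : ∀ x, |f x| ≤ C)
    (hC' : ∀ x, |f' x| ≤ C) :
    ∫ x, x * f x ∂(gaussianReal 0 1) = ∫ x, f' x ∂(gaussianReal 0 1) := by
  have hfc : Continuous f := continuous_iff_continuousAt.2 fun x => (hf x).continuousAt
  rw [integral_gaussianReal_eq_integral_smul one_ne_zero,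
    integral_gaussianReal_eq_integral_smul one_ne_zero]
  have hd : ∀ x, HasDerivAt (gaussianPDFReal 0 1) (-x * gaussianPDFReal 0 1 x) x := by
    intro x
    have h1 : HasDerivAt (fun x : ℝ => -x ^ 2 / 2) (-x) x := by
      exact (((hasDerivAt_pow 2 x).fun_neg).div_const 2).congr_deriv (by simp; ring)
    have h2 := (h1.exp).const_mul (√(2 * Real.pi))⁻¹
    rw [show gaussianPDFReal 0 1 = fun x => (√(2 * Real.pi))⁻¹ * Real.exp (-x ^ 2 / 2) from
      funext gaussianPDFReal_zero_one]
    exact h2.congr_deriv (by ring)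
  have hp := integrable_gaussianPDFReal 0 1
  have hxp : Integrable (fun x => -x * gaussianPDFReal 0 1 x) := by
    have h := (integrable_mul_exp_neg_mul_sq (b := 1 / 2) (by norm_num)).const_mul
      (-(√(2 * Real.pi))⁻¹)
    refine h.congr (ae_of_all _ fun x => ?_)
    simp only [gaussianPDFReal_zero_one]
    rw [show -(1 / 2) * x ^ 2 = -x ^ 2 / 2 by ring]; ring
  have key := integral_mul_deriv_eq_deriv_mul_of_integrable (u := f) (u' := f')
    (v := gaussianPDFReal 0 1) (v' := fun x => -x * gaussianPDFReal 0 1 x)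
    (fun x _ => hf x) (fun x _ => hd x)
    (hxp.bdd_mul hfc.aestronglyMeasurable (ae_of_all _ hC))
    (hp.bdd_mul hf'.aestronglyMeasurable (ae_of_all _ hC'))
    (hp.bdd_mul hfc.aestronglyMeasurable (ae_of_all _ hC))
  calc ∫ x, gaussianPDFReal 0 1 x • (x * f x)
      = - ∫ x, f x * (-x * gaussianPDFReal 0 1 x) := by
        rw [← integral_neg]; congr 1; ext x; simp; ring
    _ = ∫ x, gaussianPDFReal 0 1 x • f' x := by
        rw [key, neg_neg]; congr 1; ext x; simp; ring

/-- Gaussian integration by parts in one coordinate, for a bounded function whose partial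
derivative in that coordinate is bounded and continuous. -/
theorem integral_coord_mul_gaussianPi {J : Type*} [Fintype J] [DecidableEq J] (j : J)
    {f f' : (J → ℝ) → ℝ} {C : ℝ} (hfc : Continuous f) (hf' : Continuous f')
    (hf : ∀ z x, HasDerivAt (fun x => f (Function.update z j x)) (f' (Function.update z j x)) x)
    (hC : ∀ x, |f x| ≤ C) (hC' : ∀ x, |f' x| ≤ C) :
    ∫ z, z j * f z ∂(gaussianPi J) = ∫ z, f' z ∂(gaussianPi J) := by
  have hu := measurePreserving_update_pi (fun _ : J => gaussianReal 0 1) j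
  have hint : Integrable (fun z : J → ℝ => z j * f z) (gaussianPi J) :=
    (integrable_eval_gaussianPi j).mul_bdd hfc.aestronglyMeasurable (ae_of_all _ hC)
  have hint' : Integrable f' (gaussianPi J) := integrable_of_bounded_of_continuous hf' hC'
  have hmap : ∀ g : (J → ℝ) → ℝ, Integrable g (gaussianPi J) → ∫ z, g z ∂(gaussianPi J) =
      ∫ p, g (Function.update p.1 j p.2) ∂((gaussianPi J).prod (gaussianReal 0 1)) := by
    intro g hg
    rw [← integral_map (f := g) hu.aemeasurable (by rw [hu.map_eq]; exact hg.1), hu.map_eq]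
  have hi := hu.integrable_comp_of_integrable hint
  have hi' := hu.integrable_comp_of_integrable hint'
  simp only [Function.comp_def] at hi hi'
  rw [hmap _ hint, hmap _ hint', integral_prod _ hi, integral_prod _ hi']
  refine integral_congr_ae (ae_of_all _ fun z => ?_)
  have hup : Continuous fun x : ℝ => Function.update z j x :=
    continuous_const.update j continuous_id
  simpa using integral_mul_gaussianReal_eq_integral_deriv (hf z) (hf'.comp hup)
    (fun x => hC _) (fun x => hC' _)

/-! ### Log-sum-exp and the Sudakov–Fernique comparison -/

/-- The log-sum-exp function, a smooth approximation of the maximum. -/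
noncomputable def logSumExp {I : Type*} [Fintype I] (x : I → ℝ) : ℝ :=
  Real.log (∑ i, Real.exp (x i))

/-- The Gibbs weights of `x`, which form the gradient of `logSumExp`. -/
noncomputable def softmax {I : Type*} [Fintype I] (x : I → ℝ) (i : I) : ℝ :=
  Real.exp (x i) / ∑ l, Real.exp (x l)

section LogSumExp

variable {I : Type*} [Fintype I]

theorem sum_exp_pos [Nonempty I] (x : I → ℝ) : 0 < ∑ i, Real.exp (x i) :=
  Finset.sum_pos (fun _ _ => Real.exp_pos _) Finset.univ_nonempty

theorem softmax_nonneg (x : I → ℝ) (i : I) : 0 ≤ softmax x i :=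
  div_nonneg (Real.exp_nonneg _) (Finset.sum_nonneg fun _ _ => Real.exp_nonneg _)

theorem sum_softmax [Nonempty I] (x : I → ℝ) : ∑ i, softmax x i = 1 := by
  simp only [softmax, ← Finset.sum_div]
  exact div_self (sum_exp_pos x).ne'

theorem softmax_le_one [Nonempty I] (x : I → ℝ) (i : I) : softmax x i ≤ 1 := by
  rw [← sum_softmax x]
  exact Finset.single_le_sum (fun i _ => softmax_nonneg x i) (Finset.mem_univ i)

theorem abs_softmax_le_one [Nonempty I] (x : I → ℝ) (i : I) : |softmax x i| ≤ 1 := by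
  rw [abs_of_nonneg (softmax_nonneg x i)]; exact softmax_le_one x i

theorem continuous_softmax [Nonempty I] (i : I) : Continuous fun x : I → ℝ => softmax x i := by
  unfold softmax
  exact (by fun_prop : Continuous fun x : I → ℝ => Real.exp (x i)).div (by fun_prop)
    fun x => (sum_exp_pos x).ne'

theorem continuous_logSumExp [Nonempty I] : Continuous (logSumExp : (I → ℝ) → ℝ) := by
  unfold logSumExp
  exact (by fun_prop : Continuous fun x : I → ℝ => ∑ i, Real.exp (x i)).log
    fun x => (sum_exp_pos x).ne'

theorem hasDerivAt_logSumExp [Nonempty I] {x : ℝ → I → ℝ} {x' : I → ℝ} {t : ℝ}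
    (h : ∀ i, HasDerivAt (fun t => x t i) (x' i) t) :
    HasDerivAt (fun t => logSumExp (x t)) (∑ i, softmax (x t) i * x' i) t := by
  have h1 : HasDerivAt (fun t => ∑ i, Real.exp (x t i)) (∑ i, Real.exp (x t i) * x' i) t :=
    HasDerivAt.fun_sum fun i _ => (h i).exp
  refine (h1.log (sum_exp_pos _).ne').congr_deriv ?_
  rw [Finset.sum_div]
  refine Finset.sum_congr rfl fun i _ => ?_
  rw [softmax]; ring

theorem hasDerivAt_softmax [Nonempty I] {x : ℝ → I → ℝ} {x' : I → ℝ} {t : ℝ}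
    (h : ∀ i, HasDerivAt (fun t => x t i) (x' i) t) (i : I) :
    HasDerivAt (fun t => softmax (x t) i)
      (softmax (x t) i * (x' i - ∑ l, softmax (x t) l * x' l)) t := by
  have h1 : HasDerivAt (fun t => ∑ i, Real.exp (x t i)) (∑ i, Real.exp (x t i) * x' i) t :=
    HasDerivAt.fun_sum fun i _ => (h i).exp
  have hne := (sum_exp_pos (x t)).ne'
  refine ((h i).exp.fun_div h1 hne).congr_deriv ?_
  have : ∑ l, softmax (x t) l * x' l =
      (∑ l, Real.exp (x t l) * x' l) / ∑ l, Real.exp (x t l) := by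
    rw [Finset.sum_div]
    refine Finset.sum_congr rfl fun i _ => ?_
    rw [softmax]; ring
  rw [this, softmax]
  field_simp

theorem le_logSumExp [Nonempty I] (x : I → ℝ) (i : I) : x i ≤ logSumExp x := by
  rw [logSumExp, Real.le_log_iff_exp_le (sum_exp_pos x)]
  exact Finset.single_le_sum (f := fun i => Real.exp (x i)) (fun _ _ => Real.exp_nonneg _)
    (Finset.mem_univ i)

theorem logSumExp_le [Nonempty I] {x : I → ℝ} {c : ℝ} (h : ∀ i, x i ≤ c) :
    logSumExp x ≤ Real.log (Fintype.card I) + c := by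
  have hc : (0 : ℝ) < Fintype.card I := by exact_mod_cast Fintype.card_pos
  rw [← Real.log_exp c, ← Real.log_mul hc.ne' (Real.exp_pos c).ne', logSumExp]
  refine Real.log_le_log (sum_exp_pos x) ?_
  calc ∑ i, Real.exp (x i) ≤ ∑ _i : I, Real.exp c :=
        Finset.sum_le_sum fun i _ => Real.exp_le_exp.2 (h i)
    _ = _ := by simp

theorem abs_logSumExp_le [Nonempty I] (x : I → ℝ) :
    |logSumExp x| ≤ Real.log (Fintype.card I) + ∑ i, |x i| := by
  have hs : ∀ i, |x i| ≤ ∑ i, |x i| := fun i =>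
    Finset.single_le_sum (f := fun i => |x i|) (fun _ _ => abs_nonneg _) (Finset.mem_univ i)
  have hl : 0 ≤ Real.log (Fintype.card I) := Real.log_natCast_nonneg _
  rw [abs_le]
  constructor
  · obtain ⟨i⟩ := ‹Nonempty I›
    have := le_logSumExp x i
    have := hs i
    have := neg_abs_le (x i)
    linarith
  · exact logSumExp_le fun i => (le_abs_self _).trans (hs i)

theorem integrable_linear_gaussianPi {J : Type*} [Fintype J] (c : J → ℝ) :
    Integrable (fun z : J → ℝ => ∑ j, c j * z j) (gaussianPi J) :=
  integrable_finsetSum _ fun j _ => (integrable_eval_gaussianPi j).const_mul _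

theorem integrable_logSumExp_gaussianPi [Nonempty I] {J : Type*} [Fintype J] (C : I → J → ℝ) :
    Integrable (fun z : J → ℝ => logSumExp fun i => ∑ j, C i j * z j) (gaussianPi J) := by
  refine Integrable.mono' (g := fun z => Real.log (Fintype.card I) + ∑ i, |∑ j, C i j * z j|)
    ((integrable_const _).add
      (integrable_finsetSum _ fun i _ => (integrable_linear_gaussianPi (C i)).abs)) ?_
    (ae_of_all _ fun z => abs_logSumExp_le _)
  have : Continuous fun (z : J → ℝ) i => ∑ j, C i j * z j := by fun_prop
  exact (continuous_logSumExp.comp this).aestronglyMeasurable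

/-- Integration by parts for the pairing of the Gibbs weights of `C z` with the vector `D z`:
only the matrix `C Dᵀ` enters. -/
theorem integral_softmax_mul_linear [Nonempty I] {J : Type*} [Fintype J] (C D : I → J → ℝ) :
    ∫ z, ∑ i, softmax (fun i => ∑ j, C i j * z j) i * ∑ j, D i j * z j ∂(gaussianPi J) =
      ∫ z, ∑ i, softmax (fun i => ∑ j, C i j * z j) i *
        (∑ j, D i j * C i j - ∑ l, softmax (fun i => ∑ j, C i j * z j) l *
          ∑ j, D i j * C l j) ∂(gaussianPi J) := by
  classical
  set p : (J → ℝ) → I → ℝ := fun z => softmax (fun i => ∑ j, C i j * z j) with hp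
  have hpc : ∀ i, Continuous fun z => p z i := fun i =>
    (continuous_softmax i).comp
      (by fun_prop : Continuous fun (z : J → ℝ) i => ∑ j, C i j * z j)
  have hp1 : ∀ z i, |p z i| ≤ 1 := fun z i => abs_softmax_le_one _ _
  -- the integration by parts for one weight and one coordinate
  have key : ∀ i j, ∫ z, z j * p z i ∂(gaussianPi J) =
      ∫ z, p z i * (C i j - ∑ l, p z l * C l j) ∂(gaussianPi J) := by
    intro i j
    refine integral_coord_mul_gaussianPi j (C := 1 + ∑ l, (|C i j| + |C l j|)) (hpc i)
      ((hpc i).mul (continuous_const.sub (by fun_prop))) ?_ ?_ ?_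
    · intro z x
      refine hasDerivAt_softmax (x := fun x i => ∑ j', C i j' * Function.update z j x j')
        (x' := fun i => C i j) (fun i => ?_) i
      have : ∀ j' ∈ Finset.univ, HasDerivAt (fun x => C i j' * Function.update z j x j')
          (C i j' * if j' = j then 1 else 0) x := by
        intro j' _
        by_cases h : j' = j
        · subst h; simpa using (hasDerivAt_id x).const_mul (C i j')
        · simpa [h] using hasDerivAt_const x (C i j' * z j')
      simpa using HasDerivAt.fun_sum this
    · intro z
      refine (hp1 z i).trans ?_
      have : 0 ≤ ∑ l, (|C i j| + |C l j|) := by positivity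
      linarith
    · intro z
      rw [abs_mul]
      have h1 : |C i j - ∑ l, p z l * C l j| ≤ ∑ l, (|C i j| + |C l j|) := by
        have : C i j - ∑ l, p z l * C l j = ∑ l, p z l * (C i j - C l j) := by
          simp only [mul_sub, Finset.sum_sub_distrib, ← Finset.sum_mul]
          rw [hp, sum_softmax, one_mul]
        rw [this]
        refine (Finset.abs_sum_le_sum_abs _ _).trans (Finset.sum_le_sum fun l _ => ?_)
        rw [abs_mul]
        calc |p z l| * |C i j - C l j| ≤ 1 * |C i j - C l j| := by gcongr; exact hp1 z l
          _ ≤ |C i j| + |C l j| := by rw [one_mul]; exact abs_sub _ _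
      calc |p z i| * |C i j - ∑ l, p z l * C l j|
          ≤ 1 * ∑ l, (|C i j| + |C l j|) := by
            gcongr
            exact hp1 z i
        _ ≤ _ := by linarith
  have hi1 : ∀ i j, Integrable (fun z => z j * p z i) (gaussianPi J) := fun i j =>
    (integrable_eval_gaussianPi j).mul_bdd (hpc i).aestronglyMeasurable (ae_of_all _ (hp1 · i))
  have hb : ∀ i, Integrable (fun z => p z i) (gaussianPi J) := fun i =>
    integrable_of_bounded_of_continuous (hpc i) (hp1 · i)
  have hi2 : ∀ i j, Integrable (fun z => p z i * (C i j - ∑ l, p z l * C l j)) (gaussianPi J) :=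
    fun i j => ((integrable_const _).sub (integrable_finsetSum _ fun l _ =>
      (hb l).mul_const _)).bdd_mul (hpc i).aestronglyMeasurable (ae_of_all _ (hp1 · i))
  calc ∫ z, ∑ i, p z i * ∑ j, D i j * z j ∂(gaussianPi J)
      = ∫ z, ∑ i, ∑ j, D i j * (z j * p z i) ∂(gaussianPi J) := by
        congr 1; ext z
        refine Finset.sum_congr rfl fun i _ => ?_
        rw [Finset.mul_sum]
        exact Finset.sum_congr rfl fun j _ => by ring
    _ = ∑ i, ∑ j, D i j * ∫ z, z j * p z i ∂(gaussianPi J) := by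
        rw [integral_finsetSum _ fun i _ => integrable_finsetSum _ fun j _ =>
          (hi1 i j).const_mul _]
        refine Finset.sum_congr rfl fun i _ => ?_
        rw [integral_finsetSum _ fun j _ => (hi1 i j).const_mul _]
        simp only [integral_const_mul]
    _ = ∑ i, ∑ j, D i j * ∫ z, p z i * (C i j - ∑ l, p z l * C l j) ∂(gaussianPi J) := by
        simp only [key]
    _ = ∫ z, ∑ i, ∑ j, D i j * (p z i * (C i j - ∑ l, p z l * C l j)) ∂(gaussianPi J) := by
        rw [integral_finsetSum _ fun i _ => integrable_finsetSum _ fun j _ =>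
          (hi2 i j).const_mul _]
        refine Finset.sum_congr rfl fun i _ => ?_
        rw [integral_finsetSum _ fun j _ => (hi2 i j).const_mul _]
        simp only [integral_const_mul]
    _ = _ := by
        congr 1; ext z
        refine Finset.sum_congr rfl fun i _ => ?_
        have : ∑ l, p z l * ∑ j, D i j * C l j = ∑ j, D i j * ∑ l, p z l * C l j := by
          simp only [Finset.mul_sum]
          rw [Finset.sum_comm]
          exact Finset.sum_congr rfl fun j _ => Finset.sum_congr rfl fun l _ => by ring
        rw [this, ← Finset.sum_sub_distrib, Finset.mul_sum]
        exact Finset.sum_congr rfl fun j _ => by ring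

/-- For symmetric `K` the sum is half the `p ⊗ p`-average of the squared distances
`K i i + K l l - K i l - K l i`. -/
theorem sum_mul_sub_sum_nonneg (p : I → ℝ) (hp : ∀ i, 0 ≤ p i)
    (hp1 : ∑ i, p i = 1) (K : I → I → ℝ) (hK : ∀ i l, K i l + K l i ≤ K i i + K l l) :
    0 ≤ ∑ i, p i * (K i i - ∑ l, p l * K i l) := by
  have h1 : ∑ i, p i * (K i i - ∑ l, p l * K i l) = ∑ i, ∑ l, p i * p l * (K i i - K i l) := by
    refine Finset.sum_congr rfl fun i _ => ?_
    calc p i * (K i i - ∑ l, p l * K i l)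
        = p i * ((∑ l, p l) * K i i - ∑ l, p l * K i l) := by rw [hp1, one_mul]
      _ = _ := by
        rw [Finset.sum_mul, ← Finset.sum_sub_distrib, Finset.mul_sum]
        exact Finset.sum_congr rfl fun l _ => by ring
  have h2 : ∑ i, ∑ l, p i * p l * (K i i - K i l) = ∑ i, ∑ l, p i * p l * (K l l - K l i) := by
    rw [Finset.sum_comm]
    exact Finset.sum_congr rfl fun l _ => Finset.sum_congr rfl fun i _ => by ring
  have h3 : 0 ≤ ∑ i, ∑ l, p i * p l * (K i i + K l l - K i l - K l i) :=
    Finset.sum_nonneg fun i _ => Finset.sum_nonneg fun l _ =>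
      mul_nonneg (mul_nonneg (hp i) (hp l)) (by linarith [hK i l])
  have h4 : ∑ i, ∑ l, p i * p l * (K i i + K l l - K i l - K l i) =
      ∑ i, ∑ l, p i * p l * (K i i - K i l) + ∑ i, ∑ l, p i * p l * (K l l - K l i) := by
    simp only [← Finset.sum_add_distrib]
    exact Finset.sum_congr rfl fun l _ => Finset.sum_congr rfl fun i _ => by ring
  rw [h1]
  linarith

/-- **Sudakov–Fernique inequality** for the log-sum-exp function. The Gaussian vectors `A z` and
`B z` are independent because of the orthogonality of the rows, and `cos θ A z + sin θ B z`
interpolates between them; along the path the expectation is nondecreasing. -/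
theorem integral_logSumExp_le_of_dist_le [Nonempty I] {J : Type*} [Fintype J]
    (A B : I → J → ℝ) (hAB : ∀ i l, ∑ j, A i j * B l j = 0)
    (hd : ∀ i l, ∑ j, (A i j - A l j) ^ 2 ≤ ∑ j, (B i j - B l j) ^ 2) :
    ∫ z, logSumExp (fun i => ∑ j, A i j * z j) ∂(gaussianPi J) ≤
      ∫ z, logSumExp (fun i => ∑ j, B i j * z j) ∂(gaussianPi J) := by
  set C : ℝ → I → J → ℝ := fun θ i j => Real.cos θ * A i j + Real.sin θ * B i j with hC
  set D : ℝ → I → J → ℝ := fun θ i j => -Real.sin θ * A i j + Real.cos θ * B i j with hD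
  set φ : ℝ → ℝ := fun θ => ∫ z, logSumExp (fun i => ∑ j, C θ i j * z j) ∂(gaussianPi J) with hφ
  have hDb : ∀ θ i j, |D θ i j| ≤ |A i j| + |B i j| := by
    intro θ i j
    refine (abs_add_le _ _).trans (add_le_add ?_ ?_)
    · rw [abs_mul, abs_neg]
      exact mul_le_of_le_one_left (abs_nonneg _) (Real.abs_sin_le_one θ)
    · rw [abs_mul]
      exact mul_le_of_le_one_left (abs_nonneg _) (Real.abs_cos_le_one θ)
  have hderiv : ∀ θ, HasDerivAt φ (∫ z, ∑ i, softmax (fun i => ∑ j, C θ i j * z j) i *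
      ∑ j, D θ i j * z j ∂(gaussianPi J)) θ := by
    intro θ
    refine (hasDerivAt_integral_of_dominated_loc_of_deriv_le (μ := gaussianPi J)
      (F := fun θ z => logSumExp (fun i => ∑ j, C θ i j * z j))
      (F' := fun θ z => ∑ i, softmax (fun i => ∑ j, C θ i j * z j) i * ∑ j, D θ i j * z j)
      (bound := fun z => ∑ i, ∑ j, (|A i j| + |B i j|) * |z j|)
      Filter.univ_mem ?_ ?_ ?_ ?_ ?_ ?_).2
    · exact Filter.Eventually.of_forall fun θ => (integrable_logSumExp_gaussianPi (C θ)).1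
    · exact integrable_logSumExp_gaussianPi (C θ)
    · have hc : Continuous fun (z : J → ℝ) i => ∑ j, C θ i j * z j := by fun_prop
      exact (continuous_finsetSum _ fun i _ => ((continuous_softmax i).comp hc).mul
        (by fun_prop : Continuous fun z : J → ℝ => ∑ j, D θ i j * z j)).aestronglyMeasurable
    · refine ae_of_all _ fun z θ _ => ?_
      refine (Finset.abs_sum_le_sum_abs _ _).trans (Finset.sum_le_sum fun i _ => ?_)
      rw [abs_mul]
      calc |softmax (fun i => ∑ j, C θ i j * z j) i| * |∑ j, D θ i j * z j|
          ≤ 1 * |∑ j, D θ i j * z j| := by gcongr; exact abs_softmax_le_one _ _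
        _ ≤ ∑ j, |D θ i j * z j| := by rw [one_mul]; exact Finset.abs_sum_le_sum_abs _ _
        _ ≤ _ := by
          refine Finset.sum_le_sum fun j _ => ?_
          rw [abs_mul]
          gcongr
          exact hDb θ i j
    · exact integrable_finsetSum _ fun i _ => integrable_finsetSum _ fun j _ =>
        (integrable_eval_gaussianPi j).abs.const_mul _
    · refine ae_of_all _ fun z θ _ => hasDerivAt_logSumExp
        (x := fun θ i => ∑ j, C θ i j * z j) fun i => HasDerivAt.fun_sum fun j _ => ?_
      exact (((Real.hasDerivAt_cos θ).mul_const _).add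
        ((Real.hasDerivAt_sin θ).mul_const _)).mul_const _
  have hmono : MonotoneOn φ (Set.Icc 0 (Real.pi / 2)) := by
    refine monotoneOn_of_deriv_nonneg (convex_Icc _ _)
      (fun θ _ => (hderiv θ).continuousAt.continuousWithinAt)
      (fun θ _ => (hderiv θ).differentiableAt.differentiableWithinAt) fun θ hθ => ?_
    rw [interior_Icc] at hθ
    rw [(hderiv θ).deriv, integral_softmax_mul_linear]
    have hs : 0 ≤ Real.sin θ :=
      Real.sin_nonneg_of_nonneg_of_le_pi hθ.1.le (by linarith [hθ.2, Real.pi_pos])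
    have hc : 0 ≤ Real.cos θ :=
      Real.cos_nonneg_of_neg_pi_div_two_le_of_le (by linarith [hθ.1, Real.pi_pos]) hθ.2.le
    have hsc : 0 ≤ Real.sin θ * Real.cos θ := mul_nonneg hs hc
    have hK : ∀ i l, ∑ j, D θ i j * C θ l j =
        Real.sin θ * Real.cos θ * (∑ j, B i j * B l j - ∑ j, A i j * A l j) := by
      intro i l
      have : ∑ j, D θ i j * C θ l j =
          Real.sin θ * Real.cos θ * (∑ j, B i j * B l j - ∑ j, A i j * A l j)
          - Real.sin θ ^ 2 * ∑ j, A i j * B l j + Real.cos θ ^ 2 * ∑ j, A l j * B i j := by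
        simp only [Finset.mul_sum, ← Finset.sum_sub_distrib, ← Finset.sum_add_distrib]
        exact Finset.sum_congr rfl fun j _ => by simp only [hC, hD]; ring
      rw [this, hAB, hAB]; ring
    refine integral_nonneg fun z => ?_
    refine sum_mul_sub_sum_nonneg _ (softmax_nonneg _) (sum_softmax _)
      (fun i l => ∑ j, D θ i j * C θ l j) fun i l => ?_
    simp only [hK]
    have h := hd i l
    have e : ∀ M : I → J → ℝ, ∑ j, (M i j - M l j) ^ 2 =
        ∑ j, M i j * M i j + ∑ j, M l j * M l j - ∑ j, M i j * M l j - ∑ j, M l j * M i j := by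
      intro M
      simp only [← Finset.sum_sub_distrib, ← Finset.sum_add_distrib]
      exact Finset.sum_congr rfl fun j _ => by ring
    rw [e, e] at h
    nlinarith [mul_le_mul_of_nonneg_left h hsc]
  have := hmono (Set.left_mem_Icc.2 (by positivity)) (Set.right_mem_Icc.2 (by positivity))
    (by positivity : (0 : ℝ) ≤ Real.pi / 2)
  simpa [hφ, hC] using this

end LogSumExp

/-! ### Chevet's inequality -/

theorem ProbabilityTheory.HasLaw.integrable_comp {Ω 𝓧 : Type*} [MeasurableSpace Ω]
    [MeasurableSpace 𝓧] {P : Measure Ω} {μ : Measure 𝓧} {X : Ω → 𝓧} (hX : HasLaw X μ P)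
    {f : 𝓧 → ℝ} (hf : Integrable f μ) : Integrable (fun ω => f (X ω)) P := by
  have := hX.map_eq ▸ hf
  exact this.comp_aemeasurable hX.aemeasurable

/-- The finite form of Chevet's inequality: the process `⟨z, β a bᵀ⟩` is compared with
`⟨g, β a⟩ + ⟨h, β b⟩`. The increments are ordered because
`(1 - ⟨a, a'⟩) (1 - ⟨b, b'⟩) ≥ 0` for unit vectors. -/
theorem integral_logSumExp_rankOne_le {m₁ m₂ : ℕ} {I : Type*} [Fintype I] [Nonempty I]
    (a : I → EuclideanSpace ℝ (Fin m₁)) (b : I → EuclideanSpace ℝ (Fin m₂))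
    (ha : ∀ i, ‖a i‖ = 1) (hb : ∀ i, ‖b i‖ = 1) {U : (Fin m₁ → ℝ) → ℝ} {V : (Fin m₂ → ℝ) → ℝ}
    (hU : Integrable U (gaussianPi (Fin m₁))) (hV : Integrable V (gaussianPi (Fin m₂)))
    (haU : ∀ i g, ∑ r, a i r * g r ≤ U g) (hbV : ∀ i h, ∑ c, b i c * h c ≤ V h)
    {β : ℝ} (hβ : 0 ≤ β) :
    ∫ z, logSumExp (fun i => ∑ p : Fin m₁ × Fin m₂, β * (a i p.1 * b i p.2) * z p)
        ∂(gaussianPi (Fin m₁ × Fin m₂)) ≤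
      Real.log (Fintype.card I) +
        β * (∫ g, U g ∂(gaussianPi (Fin m₁)) + ∫ h, V h ∂(gaussianPi (Fin m₂))) := by
  let J := (Fin m₁ × Fin m₂) ⊕ (Fin m₁ ⊕ Fin m₂)
  let A : I → J → ℝ := fun i => Sum.elim (fun p => β * (a i p.1 * b i p.2)) fun _ => 0
  let B : I → J → ℝ := fun i => Sum.elim (fun _ => 0)
    (Sum.elim (fun r => β * a i r) fun c => β * b i c)
  have hinner : ∀ {n : ℕ} (x y : EuclideanSpace ℝ (Fin n)), ∑ r, x r * y r = inner ℝ x y := by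
    intro n x y
    simp [PiLp.inner_apply, mul_comm]
  have hself : ∀ {n : ℕ} (x : EuclideanSpace ℝ (Fin n)), ‖x‖ = 1 → ∑ r, x r ^ 2 = 1 := by
    intro n x hx
    simp only [sq, hinner, real_inner_self_eq_norm_sq, hx, mul_one]
  have hle : ∀ {n : ℕ} (x y : EuclideanSpace ℝ (Fin n)), ‖x‖ = 1 → ‖y‖ = 1 →
      ∑ r, x r * y r ≤ 1 := by
    intro n x y hx hy
    rw [hinner]
    simpa [hx, hy] using real_inner_le_norm x y
  have hcmp := integral_logSumExp_le_of_dist_le A B (by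
      intro i l
      simp [A, B, J, Fintype.sum_sum_type]) (by
      intro i l
      have e1 : ∑ j, (A i j - A l j) ^ 2 = β ^ 2 *
          (2 - 2 * (∑ r, a i r * a l r) * (∑ c, b i c * b l c)) := by
        calc ∑ j, (A i j - A l j) ^ 2
            = ∑ r, ∑ c, (β * (a i r * b i c) - β * (a l r * b l c)) ^ 2 := by
              simp [A, J, Fintype.sum_sum_type, Fintype.sum_prod_type]
          _ = ∑ r, ∑ c, β ^ 2 * (a i r ^ 2 * b i c ^ 2 + a l r ^ 2 * b l c ^ 2
                - 2 * (a i r * a l r * (b i c * b l c))) :=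
              Finset.sum_congr rfl fun r _ => Finset.sum_congr rfl fun c _ => by ring
          _ = β ^ 2 * ((∑ r, a i r ^ 2) * (∑ c, b i c ^ 2) + (∑ r, a l r ^ 2) * (∑ c, b l c ^ 2)
                - 2 * ((∑ r, a i r * a l r) * (∑ c, b i c * b l c))) := by
              simp only [Finset.sum_mul_sum, ← Finset.mul_sum, Finset.sum_sub_distrib,
                Finset.sum_add_distrib]
          _ = _ := by
              rw [hself _ (ha i), hself _ (ha l), hself _ (hb i), hself _ (hb l)]; ring
      have e2 : ∑ j, (B i j - B l j) ^ 2 = β ^ 2 *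
          (4 - 2 * (∑ r, a i r * a l r) - 2 * (∑ c, b i c * b l c)) := by
        have e : ∀ {n : ℕ} (x y : EuclideanSpace ℝ (Fin n)), ‖x‖ = 1 → ‖y‖ = 1 →
            ∑ r, (β * x r - β * y r) ^ 2 = β ^ 2 * (2 - 2 * ∑ r, x r * y r) := by
          intro n x y hx hy
          calc ∑ r, (β * x r - β * y r) ^ 2
              = ∑ r, β ^ 2 * (x r ^ 2 + y r ^ 2 - 2 * (x r * y r)) :=
                Finset.sum_congr rfl fun r _ => by ring
            _ = β ^ 2 * (∑ r, x r ^ 2 + ∑ r, y r ^ 2 - 2 * ∑ r, x r * y r) := by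
                simp only [← Finset.mul_sum, Finset.sum_sub_distrib, Finset.sum_add_distrib]
            _ = _ := by rw [hself x hx, hself y hy]; ring
        calc ∑ j, (B i j - B l j) ^ 2
            = ∑ r, (β * a i r - β * a l r) ^ 2 + ∑ c, (β * b i c - β * b l c) ^ 2 := by
              simp [B, J, Fintype.sum_sum_type]
          _ = _ := by rw [e _ _ (ha i) (ha l), e _ _ (hb i) (hb l)]; ring
      rw [e1, e2]
      have h1 := hle _ _ (ha i) (ha l)
      have h2 := hle _ _ (hb i) (hb l)
      refine mul_le_mul_of_nonneg_left ?_ (sq_nonneg β)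
      nlinarith [mul_nonneg (sub_nonneg.2 h1) (sub_nonneg.2 h2)])
  have law0 : HasLaw (fun (z : J → ℝ) p => z (Sum.inl p)) (gaussianPi (Fin m₁ × Fin m₂))
      (gaussianPi J) := hasLaw_comp_gaussianPi Sum.inl_injective
  have law1 : HasLaw (fun (z : J → ℝ) r => z (Sum.inr (Sum.inl r))) (gaussianPi (Fin m₁))
      (gaussianPi J) := hasLaw_comp_gaussianPi (Sum.inr_injective.comp Sum.inl_injective)
  have law2 : HasLaw (fun (z : J → ℝ) c => z (Sum.inr (Sum.inr c))) (gaussianPi (Fin m₂))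
      (gaussianPi J) := hasLaw_comp_gaussianPi (Sum.inr_injective.comp Sum.inr_injective)
  have hU' := law1.integrable_comp hU
  have hV' := law2.integrable_comp hV
  have hUV : Integrable (fun z : J → ℝ => U (fun r => z (Sum.inr (Sum.inl r))) +
    V (fun c => z (Sum.inr (Sum.inr c)))) (gaussianPi J) := hU'.add hV'
  have hL := law0.integral_comp (integrable_logSumExp_gaussianPi
    (fun i (p : Fin m₁ × Fin m₂) => β * (a i p.1 * b i p.2))).1
  have hU2 := law1.integral_comp hU.1
  have hV2 := law2.integral_comp hV.1
  simp only [Function.comp_def] at hL hU2 hV2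
  rw [← hL, ← hU2, ← hV2]
  calc _ = ∫ z, logSumExp (fun i => ∑ j, A i j * z j) ∂(gaussianPi J) := by
        congr 1; ext z; congr 1; ext i
        simp [A, J, Fintype.sum_sum_type]
    _ ≤ ∫ z, logSumExp (fun i => ∑ j, B i j * z j) ∂(gaussianPi J) := hcmp
    _ ≤ ∫ z, (Real.log (Fintype.card I) + β * (U (fun r => z (Sum.inr (Sum.inl r))) +
          V (fun c => z (Sum.inr (Sum.inr c))))) ∂(gaussianPi J) := by
        refine integral_mono (integrable_logSumExp_gaussianPi B)
          ((integrable_const _).add (hUV.const_mul _)) fun z => logSumExp_le fun i => ?_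
        have : ∑ j, B i j * z j = β * (∑ r, a i r * z (Sum.inr (Sum.inl r)) +
            ∑ c, b i c * z (Sum.inr (Sum.inr c))) := by
          simp [B, J, Fintype.sum_sum_type, mul_add, Finset.mul_sum, mul_assoc]
        rw [this]
        exact mul_le_mul_of_nonneg_left (add_le_add (haU i _) (hbV i _)) hβ
    _ = _ := by
        rw [integral_add (integrable_const _) (hUV.const_mul _), integral_const_mul,
          integral_add hU' hV']
        simp

theorem matInner_rankOne {m₁ m₂ : ℕ} (X : Matrix (Fin m₁) (Fin m₂) ℝ)
    (a : EuclideanSpace ℝ (Fin m₁)) (b : EuclideanSpace ℝ (Fin m₂)) :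
    matInner X (Matrix.of fun i j => a i * b j) = ∑ i, ∑ j, X i j * (a i * b j) := by
  simp [matInner_eq]

/-- **Chevet's inequality**. If every upper bound of the forms `aᵀ G b`, `(a, b) ∈ s`, is an upper
bound of `Φ`, then the expectation of `Φ` is at most that of `sup ⟨a, g⟩ + sup ⟨b, h⟩`, here
replaced by any integrable upper bounds `U` and `V`. A finite net of `s` and a large inverse
temperature reduce it to its finite form. -/
theorem chevet {Ω : Type*} [MeasurableSpace Ω] {P : Measure Ω} [IsProbabilityMeasure P]
    {m₁ m₂ : ℕ} {G : Ω → Matrix (Fin m₁) (Fin m₂) ℝ}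
    (hG : HasLaw (fun ω (p : Fin m₁ × Fin m₂) => G ω p.1 p.2) (gaussianPi (Fin m₁ × Fin m₂)) P)
    {s : Set (EuclideanSpace ℝ (Fin m₁) × EuclideanSpace ℝ (Fin m₂))} (hs : s.Nonempty)
    (hs1 : ∀ x ∈ s, ‖x.1‖ = 1 ∧ ‖x.2‖ = 1) {Φ : Ω → ℝ} (hΦ : Integrable Φ P)
    (hle : ∀ ω c, (∀ x ∈ s, matInner (G ω) (Matrix.of fun i j => x.1 i * x.2 j) ≤ c) → Φ ω ≤ c)
    {U : (Fin m₁ → ℝ) → ℝ} {V : (Fin m₂ → ℝ) → ℝ}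
    (hU : Integrable U (gaussianPi (Fin m₁))) (hV : Integrable V (gaussianPi (Fin m₂)))
    (haU : ∀ x ∈ s, ∀ g, ∑ r, x.1 r * g r ≤ U g) (hbV : ∀ x ∈ s, ∀ h, ∑ c, x.2 c * h c ≤ V h) :
    ∫ ω, Φ ω ∂P ≤ ∫ g, U g ∂(gaussianPi (Fin m₁)) + ∫ h, V h ∂(gaussianPi (Fin m₂)) := by
  have hentry : ∀ i j, Integrable (fun ω => G ω i j) P := fun i j =>
    hG.integrable_comp (f := fun z => z (i, j)) (integrable_eval_gaussianPi (i, j))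
  set S : Ω → ℝ := fun ω => ∑ i, ∑ j, |G ω i j| with hS
  have hSi : Integrable S P := integrable_finsetSum _ fun i _ => integrable_finsetSum _ fun j _ =>
    (hentry i j).abs
  have hS0 : 0 ≤ ∫ ω, S ω ∂P := integral_nonneg fun ω => by positivity
  have hbdd : TotallyBounded s := by
    have : Bornology.IsBounded s :=
      (Metric.isBounded_closedBall (x := 0) (r := 1)).subset fun x hx => by
        rw [mem_closedBall_zero_iff, Prod.norm_def, (hs1 x hx).1, (hs1 x hx).2, max_self]
    exact this.isCompact_closure.totallyBounded.subset subset_closure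
  refine le_of_forall_pos_le_add fun δ hδ => ?_
  -- The mesh `ε` and the inverse temperature `β` make the discretization error and the entropy
  -- term `log (card t) / β` at most `δ / 2` each.
  set ε : ℝ := δ / (4 * (∫ ω, S ω ∂P + 1)) with hε
  have hε0 : 0 < ε := by positivity
  obtain ⟨t, hts, htf, hst⟩ := Metric.finite_approx_of_totallyBounded hbdd ε hε0
  have : Fintype t := htf.fintype
  have : Nonempty t := by
    obtain ⟨x, hx⟩ := hs
    obtain ⟨y, hy, -⟩ := Set.mem_iUnion₂.1 (hst hx)
    exact ⟨⟨y, hy⟩⟩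
  have hl : 0 ≤ Real.log (Fintype.card t) := Real.log_natCast_nonneg _
  set β : ℝ := 2 * (Real.log (Fintype.card t) + 1) / δ with hβ
  have hβ0 : 0 < β := by positivity
  set L : (Fin m₁ × Fin m₂ → ℝ) → ℝ := fun z =>
    logSumExp (fun x : t => ∑ p : Fin m₁ × Fin m₂, β * (x.1.1 p.1 * x.1.2 p.2) * z p) with hL
  have hLi : Integrable L (gaussianPi (Fin m₁ × Fin m₂)) := integrable_logSumExp_gaussianPi
    (fun (x : t) (p : Fin m₁ × Fin m₂) => β * (x.1.1 p.1 * x.1.2 p.2))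
  have hLle := integral_logSumExp_rankOne_le (fun x : t => x.1.1) (fun x : t => x.1.2)
    (fun x => (hs1 _ (hts x.2)).1) (fun x => (hs1 _ (hts x.2)).2) hU hV
    (fun x => haU _ (hts x.2)) (fun x => hbV _ (hts x.2)) hβ0.le
  have hpt : ∀ ω, Φ ω ≤ β⁻¹ * L (fun p => G ω p.1 p.2) + 2 * ε * S ω := by
    refine fun ω => hle ω _ fun x hx => ?_
    obtain ⟨y, hy, hxy⟩ := Set.mem_iUnion₂.1 (hst hx)
    rw [Metric.mem_ball, dist_eq_norm, Prod.norm_def, max_lt_iff] at hxy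
    have h1 : matInner (G ω) (Matrix.of fun i j => y.1 i * y.2 j) ≤
        β⁻¹ * L (fun p => G ω p.1 p.2) := by
      rw [← div_eq_inv_mul, le_div_iff₀ hβ0]
      refine le_trans (le_of_eq ?_) (le_logSumExp _ (⟨y, hy⟩ : t))
      simp only [matInner_rankOne, Fintype.sum_prod_type, Finset.sum_mul]
      exact Finset.sum_congr rfl fun i _ => Finset.sum_congr rfl fun j _ => by ring
    have h2 : matInner (G ω) (Matrix.of fun i j => x.1 i * x.2 j) -
        matInner (G ω) (Matrix.of fun i j => y.1 i * y.2 j) ≤ 2 * ε * S ω := by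
      simp only [matInner_rankOne, hS, ← Finset.sum_sub_distrib, Finset.mul_sum]
      refine Finset.sum_le_sum fun i _ => Finset.sum_le_sum fun j _ => ?_
      have c1 : |x.1 i - y.1 i| ≤ ε := (PiLp.norm_apply_le (x.1 - y.1) i).trans hxy.1.le
      have c2 : |x.2 j - y.2 j| ≤ ε := (PiLp.norm_apply_le (x.2 - y.2) j).trans hxy.2.le
      have c3 : |x.1 i| ≤ 1 := (PiLp.norm_apply_le x.1 i).trans (hs1 x hx).1.le
      have c4 : |y.2 j| ≤ 1 := (PiLp.norm_apply_le y.2 j).trans (hs1 y (hts hy)).2.le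
      have c5 : |x.1 i * x.2 j - y.1 i * y.2 j| ≤ 2 * ε := by
        calc |x.1 i * x.2 j - y.1 i * y.2 j|
            = |x.1 i * (x.2 j - y.2 j) + (x.1 i - y.1 i) * y.2 j| := by congr 1; ring
          _ ≤ |x.1 i| * |x.2 j - y.2 j| + |x.1 i - y.1 i| * |y.2 j| := by
              rw [← abs_mul, ← abs_mul]; exact abs_add_le _ _
          _ ≤ 1 * ε + ε * 1 := by gcongr
          _ = 2 * ε := by ring
      calc G ω i j * (x.1 i * x.2 j) - G ω i j * (y.1 i * y.2 j)
          ≤ |G ω i j * (x.1 i * x.2 j) - G ω i j * (y.1 i * y.2 j)| := le_abs_self _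
        _ = |x.1 i * x.2 j - y.1 i * y.2 j| * |G ω i j| := by
            rw [← mul_sub, abs_mul, mul_comm]
        _ ≤ 2 * ε * |G ω i j| := by gcongr
    linarith
  have hL2 := hG.integral_comp hLi.1
  simp only [Function.comp_def] at hL2
  have hLiΩ := hG.integrable_comp hLi
  calc ∫ ω, Φ ω ∂P ≤ ∫ ω, (β⁻¹ * L (fun p => G ω p.1 p.2) + 2 * ε * S ω) ∂P :=
        integral_mono hΦ ((hLiΩ.const_mul _).add (hSi.const_mul _)) hpt
    _ = β⁻¹ * ∫ z, L z ∂(gaussianPi (Fin m₁ × Fin m₂)) + 2 * ε * ∫ ω, S ω ∂P := by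
        rw [integral_add (hLiΩ.const_mul _) (hSi.const_mul _), integral_const_mul,
          integral_const_mul, hL2]
    _ ≤ β⁻¹ * (Real.log (Fintype.card t) + β * (∫ g, U g ∂(gaussianPi (Fin m₁)) +
          ∫ h, V h ∂(gaussianPi (Fin m₂)))) + 2 * ε * ∫ ω, S ω ∂P := by
        gcongr
    _ ≤ _ := by
        rw [mul_add, inv_mul_cancel_left₀ hβ0.ne']
        have e1 : β⁻¹ * Real.log (Fintype.card t) ≤ δ / 2 := by
          rw [← div_eq_inv_mul, div_le_iff₀ hβ0, hβ]
          have : δ / 2 * (2 * (Real.log (Fintype.card t) + 1) / δ) =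
            Real.log (Fintype.card t) + 1 := by field_simp
          linarith
        have e2 : 2 * ε * ∫ ω, S ω ∂P ≤ δ / 2 := by
          rw [hε, show 2 * (δ / (4 * (∫ ω, S ω ∂P + 1))) * ∫ ω, S ω ∂P =
            δ / 2 * ((∫ ω, S ω ∂P) / (∫ ω, S ω ∂P + 1)) by field_simp; ring]
          exact mul_le_of_le_one_right (by positivity) (div_le_one_of_le₀ (by linarith)
            (by positivity))
        linarith

/-! ### Dual norms of matrices -/

section DualNorm

variable {m₁ m₂ : ℕ}

theorem integrable_of_le_add_sum_abs_sub {Ω : Type*} [MeasurableSpace Ω] {P : Measure Ω}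
    {G : Ω → Matrix (Fin m₁) (Fin m₂) ℝ}
    (hG : HasLaw (fun ω (p : Fin m₁ × Fin m₂) => G ω p.1 p.2) (gaussianPi (Fin m₁ × Fin m₂)) P)
    {Φ : Matrix (Fin m₁) (Fin m₂) ℝ → ℝ} {C : ℝ}
    (hΦ : ∀ X Y, Φ X ≤ Φ Y + C * ∑ i, ∑ j, |X i j - Y i j|) :
    Integrable (fun ω => Φ (G ω)) P := by
  set f : (Fin m₁ × Fin m₂ → ℝ) → ℝ := fun z => Φ (Matrix.of fun i j => z (i, j)) with hf
  have habs : ∀ z w, |f z - f w| ≤ C * ∑ i, ∑ j, |z (i, j) - w (i, j)| := by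
    intro z w
    have h1 := hΦ (Matrix.of fun i j => z (i, j)) (Matrix.of fun i j => w (i, j))
    have h2 := hΦ (Matrix.of fun i j => w (i, j)) (Matrix.of fun i j => z (i, j))
    simp only [Matrix.of_apply] at h1 h2
    simp only [abs_sub_comm (w _)] at h2
    rw [abs_le]
    constructor <;> simp only [hf] <;> linarith
  have hc : Continuous f := by
    refine continuous_iff_continuousAt.2 fun w => tendsto_iff_dist_tendsto_zero.2 ?_
    refine squeeze_zero (fun _ => dist_nonneg) (fun z => habs z w) ?_
    have : Continuous fun z : Fin m₁ × Fin m₂ → ℝ => C * ∑ i, ∑ j, |z (i, j) - w (i, j)| := by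
      fun_prop
    simpa using this.tendsto w
  have hi : Integrable f (gaussianPi (Fin m₁ × Fin m₂)) := by
    refine Integrable.mono' (g := fun z => |f 0| + C * ∑ i, ∑ j, |z (i, j)|)
      ((integrable_const _).add ((integrable_finsetSum _ fun i _ => integrable_finsetSum _
        fun j _ => (integrable_eval_gaussianPi (i, j)).abs).const_mul _))
      hc.aestronglyMeasurable (ae_of_all _ fun z => ?_)
    have h1 := habs z 0
    simp only [Pi.zero_apply, sub_zero] at h1
    have h2 := abs_sub_abs_le_abs_sub (f z) (f 0)
    rw [Real.norm_eq_abs]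
    linarith
  exact hG.integrable_comp hi

theorem matInner_single (X : Matrix (Fin m₁) (Fin m₂) ℝ) (i : Fin m₁) (j : Fin m₂) (c : ℝ) :
    matInner (Matrix.single i j c) X = c * X i j := by
  simp [matInner_eq, Matrix.single_apply, ite_and]

/-- Boundedness of all the sets that define the dual norm bounds the entries of the unit ball. -/
theorem exists_entry_le_of_bddAbove {N : Matrix (Fin m₁) (Fin m₂) ℝ → ℝ}
    (hN : ∀ X, BddAbove {r : ℝ | ∃ Z, N Z ≤ 1 ∧ r = matInner X Z}) :
    ∃ C, ∀ Z, N Z ≤ 1 → ∀ i j, |Z i j| ≤ C := by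
  choose B hB using hN
  refine ⟨∑ i, ∑ j, (|B (Matrix.single i j 1)| + |B (Matrix.single i j (-1))|),
    fun Z hZ i j => ?_⟩
  have h1 := hB (Matrix.single i j 1) ⟨Z, hZ, rfl⟩
  have h2 := hB (Matrix.single i j (-1)) ⟨Z, hZ, rfl⟩
  rw [matInner_single] at h1 h2
  have h3 : |Z i j| ≤ |B (Matrix.single i j 1)| + |B (Matrix.single i j (-1))| := by
    have := le_abs_self (B (Matrix.single i j 1))
    have := le_abs_self (B (Matrix.single i j (-1)))
    have := abs_nonneg (B (Matrix.single i j 1))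
    have := abs_nonneg (B (Matrix.single i j (-1)))
    rw [abs_le]; constructor <;> linarith
  refine h3.trans ?_
  refine le_trans ?_ (Finset.single_le_sum (f := fun i => ∑ j, (|B (Matrix.single i j 1)| +
    |B (Matrix.single i j (-1))|)) (fun _ _ => by positivity) (Finset.mem_univ i))
  exact Finset.single_le_sum (f := fun j => |B (Matrix.single i j 1)| +
    |B (Matrix.single i j (-1))|) (fun _ _ => by positivity) (Finset.mem_univ j)

theorem dualNorm_le {N : Matrix (Fin m₁) (Fin m₂) ℝ → ℝ} (h0 : N 0 ≤ 1)
    {X : Matrix (Fin m₁) (Fin m₂) ℝ} {c : ℝ} (h : ∀ Z, N Z ≤ 1 → matInner X Z ≤ c) :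
    dualNorm N X ≤ c := by
  refine csSup_le ⟨_, 0, h0, rfl⟩ ?_
  rintro r ⟨Z, hZ, rfl⟩
  exact h Z hZ

theorem integrable_dualNorm {Ω : Type*} [MeasurableSpace Ω] {P : Measure Ω}
    {G : Ω → Matrix (Fin m₁) (Fin m₂) ℝ}
    (hG : HasLaw (fun ω (p : Fin m₁ × Fin m₂) => G ω p.1 p.2) (gaussianPi (Fin m₁ × Fin m₂)) P)
    {N : Matrix (Fin m₁) (Fin m₂) ℝ → ℝ} (h0 : N 0 ≤ 1)
    (hN : ∀ X, BddAbove {r : ℝ | ∃ Z, N Z ≤ 1 ∧ r = matInner X Z}) :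
    Integrable (fun ω => dualNorm N (G ω)) P := by
  obtain ⟨C, hC⟩ := exists_entry_le_of_bddAbove hN
  refine integrable_of_le_add_sum_abs_sub hG (C := C) fun X Y => dualNorm_le h0 fun Z hZ => ?_
  have h1 : matInner Y Z ≤ dualNorm N Y := le_csSup (hN Y) ⟨Z, hZ, rfl⟩
  have h2 : matInner X Z - matInner Y Z ≤ C * ∑ i, ∑ j, |X i j - Y i j| := by
    simp only [matInner_eq, ← Finset.sum_sub_distrib, Finset.mul_sum]
    refine Finset.sum_le_sum fun i _ => Finset.sum_le_sum fun j _ => ?_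
    calc X i j * Z i j - Y i j * Z i j ≤ |X i j * Z i j - Y i j * Z i j| := le_abs_self _
      _ = |Z i j| * |X i j - Y i j| := by rw [← sub_mul, abs_mul, mul_comm]
      _ ≤ C * |X i j - Y i j| := by gcongr; exact hC Z hZ i j
  linarith

theorem abs_entry_le_entryMaxNorm (X : Matrix (Fin m₁) (Fin m₂) ℝ) (i : Fin m₁) (j : Fin m₂) :
    |X i j| ≤ entryMaxNorm X :=
  le_ciSup (f := fun p : Fin m₁ × Fin m₂ => |X p.1 p.2|) (Set.finite_range _).bddAbove (i, j)

theorem entryL1Norm_zero : entryL1Norm (0 : Matrix (Fin m₁) (Fin m₂) ℝ) = 0 := by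
  simp [entryL1Norm]

theorem dualNorm_entryL1Norm_le (X : Matrix (Fin m₁) (Fin m₂) ℝ) :
    dualNorm entryL1Norm X ≤ entryMaxNorm X := by
  have hX : 0 ≤ entryMaxNorm X := Real.iSup_nonneg fun _ => abs_nonneg _
  refine dualNorm_le (by simp [entryL1Norm_zero]) fun Z hZ => ?_
  calc matInner X Z ≤ ∑ i, ∑ j, entryMaxNorm X * |Z i j| := by
        rw [matInner_eq]
        refine Finset.sum_le_sum fun i _ => Finset.sum_le_sum fun j _ => ?_
        refine (le_abs_self _).trans ?_
        rw [abs_mul]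
        gcongr
        exact abs_entry_le_entryMaxNorm X i j
    _ = entryMaxNorm X * entryL1Norm Z := by simp only [entryL1Norm, Finset.mul_sum]
    _ ≤ entryMaxNorm X := mul_le_of_le_one_right hX hZ

theorem integrable_entryMaxNorm {Ω : Type*} [MeasurableSpace Ω] {P : Measure Ω}
    {G : Ω → Matrix (Fin m₁) (Fin m₂) ℝ}
    (hG : HasLaw (fun ω (p : Fin m₁ × Fin m₂) => G ω p.1 p.2) (gaussianPi (Fin m₁ × Fin m₂)) P) :
    Integrable (fun ω => entryMaxNorm (G ω)) P := by
  refine integrable_of_le_add_sum_abs_sub hG (C := 1) fun X Y => ?_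
  have hY : 0 ≤ entryMaxNorm Y := Real.iSup_nonneg fun _ => abs_nonneg _
  refine Real.iSup_le (fun p => ?_) (by positivity)
  have h1 := abs_entry_le_entryMaxNorm Y p.1 p.2
  have h2 := abs_sub_abs_le_abs_sub (X p.1 p.2) (Y p.1 p.2)
  have h3 : |X p.1 p.2 - Y p.1 p.2| ≤ ∑ i, ∑ j, |X i j - Y i j| :=
    (Finset.single_le_sum (f := fun j => |X p.1 j - Y p.1 j|) (fun _ _ => abs_nonneg _)
      (Finset.mem_univ p.2)).trans
    (Finset.single_le_sum (f := fun i => ∑ j, |X i j - Y i j|)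
      (fun _ _ => Finset.sum_nonneg fun _ _ => abs_nonneg _) (Finset.mem_univ p.1))
  linarith

theorem inner_toEuclideanLin (X : Matrix (Fin m₁) (Fin m₂) ℝ)
    (a : EuclideanSpace ℝ (Fin m₁)) (b : EuclideanSpace ℝ (Fin m₂)) :
    inner ℝ a (Matrix.toEuclideanLin X b) = matInner X (Matrix.of fun i j => a i * b j) := by
  simp only [matInner_rankOne, PiLp.inner_apply, Matrix.toLpLin_apply, Matrix.mulVec, dotProduct]
  simp only [RCLike.inner_apply, conj_trivial, Finset.sum_mul]
  exact Finset.sum_congr rfl fun i _ => Finset.sum_congr rfl fun j _ => by ring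

theorem opNorm_nonneg (X : Matrix (Fin m₁) (Fin m₂) ℝ) : 0 ≤ opNorm X := norm_nonneg _

theorem norm_toEuclideanLin_le (X : Matrix (Fin m₁) (Fin m₂) ℝ)
    (b : EuclideanSpace ℝ (Fin m₂)) : ‖Matrix.toEuclideanLin X b‖ ≤ opNorm X * ‖b‖ :=
  (Matrix.toEuclideanLin X).toContinuousLinearMap.le_opNorm b

theorem opNorm_le {X : Matrix (Fin m₁) (Fin m₂) ℝ} {c : ℝ} (hc : 0 ≤ c)
    (h : ∀ (a : EuclideanSpace ℝ (Fin m₁)) (b : EuclideanSpace ℝ (Fin m₂)), ‖a‖ = 1 → ‖b‖ = 1 →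
      matInner X (Matrix.of fun i j => a i * b j) ≤ c) : opNorm X ≤ c := by
  refine ContinuousLinearMap.opNorm_le_bound _ hc fun b => ?_
  change ‖Matrix.toEuclideanLin X b‖ ≤ c * ‖b‖
  set y := Matrix.toEuclideanLin X b with hy
  by_cases hy0 : y = 0
  · rw [hy0, norm_zero]; positivity
  have hb0 : b ≠ 0 := by
    rintro rfl
    simp [hy] at hy0
  have hyn : ‖y‖ ≠ 0 := norm_ne_zero_iff.2 hy0
  have hbn : ‖b‖ ≠ 0 := norm_ne_zero_iff.2 hb0
  have key := h (‖y‖⁻¹ • y) (‖b‖⁻¹ • b) (by rw [norm_smul, norm_inv, norm_norm, inv_mul_cancel₀ hyn])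
    (by rw [norm_smul, norm_inv, norm_norm, inv_mul_cancel₀ hbn])
  rw [← inner_toEuclideanLin, map_smul, ← hy, inner_smul_left, inner_smul_right,
    real_inner_self_eq_norm_sq] at key
  have hb' : 0 < ‖b‖ := norm_pos_iff.2 hb0
  have e : (starRingEnd ℝ) ‖y‖⁻¹ * (‖b‖⁻¹ * ‖y‖ ^ 2) = ‖y‖ / ‖b‖ := by
    simp only [conj_trivial]; field_simp
  rwa [e, div_le_iff₀ hb'] at key

theorem opNorm_le_sum_abs (X : Matrix (Fin m₁) (Fin m₂) ℝ) : opNorm X ≤ ∑ i, ∑ j, |X i j| := by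
  refine opNorm_le (by positivity) fun a b ha hb => ?_
  rw [matInner_rankOne]
  refine Finset.sum_le_sum fun i _ => Finset.sum_le_sum fun j _ => ?_
  have c3 : |a i| ≤ 1 := (PiLp.norm_apply_le a i).trans ha.le
  have c4 : |b j| ≤ 1 := (PiLp.norm_apply_le b j).trans hb.le
  refine (le_abs_self _).trans ?_
  rw [abs_mul, abs_mul]
  exact mul_le_of_le_one_right (abs_nonneg _) (mul_le_one₀ c3 (abs_nonneg _) c4)

theorem integrable_opNorm {Ω : Type*} [MeasurableSpace Ω] {P : Measure Ω}
    {G : Ω → Matrix (Fin m₁) (Fin m₂) ℝ}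
    (hG : HasLaw (fun ω (p : Fin m₁ × Fin m₂) => G ω p.1 p.2) (gaussianPi (Fin m₁ × Fin m₂)) P) :
    Integrable (fun ω => opNorm (G ω)) P := by
  refine integrable_of_le_add_sum_abs_sub hG (C := 1) fun X Y => ?_
  have h1 : opNorm X ≤ opNorm Y + opNorm (X - Y) := by
    have : X = Y + (X - Y) := by abel
    conv_lhs => rw [this]
    simp only [opNorm, map_add]
    exact norm_add_le _ _
  have h2 := opNorm_le_sum_abs (X - Y)
  simp only [Matrix.sub_apply] at h2
  linarith

theorem traceNorm_zero : traceNorm (0 : Matrix (Fin m₁) (Fin m₂) ℝ) = 0 := by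
  simp [traceNorm]

/-- The trace is evaluated in an eigenbasis of `Zᵀ Z`, on which `Z` acts with the singular values
as norms. -/
theorem matInner_le_opNorm_mul_traceNorm (X Z : Matrix (Fin m₁) (Fin m₂) ℝ) :
    matInner X Z ≤ opNorm X * traceNorm Z := by
  set T := Matrix.toEuclideanLin Z with hT
  set R := Matrix.toEuclideanLin X with hR
  have hn : Module.finrank ℝ (EuclideanSpace ℝ (Fin m₂)) = m₂ := by simp
  set b := T.isSymmetric_adjoint_comp_self.eigenvectorBasis hn with hb
  have hnorm : ∀ l, ‖T (b l)‖ = T.singularValues l := by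
    intro l
    have h1 : ‖T (b l)‖ ^ 2 = T.singularValues l ^ 2 := by
      rw [T.sq_singularValues_fin hn l, ← real_inner_self_eq_norm_sq,
        ← LinearMap.adjoint_inner_left]
      have := T.isSymmetric_adjoint_comp_self.apply_eigenvectorBasis hn l
      rw [LinearMap.comp_apply] at this
      rw [hb, this, inner_smul_left, real_inner_self_eq_norm_sq]
      simp
    exact (sq_eq_sq₀ (norm_nonneg _) (T.singularValues_nonneg _)).1 h1
  have htr : ∀ e : OrthonormalBasis (Fin m₂) ℝ (EuclideanSpace ℝ (Fin m₂)),
      LinearMap.trace ℝ _ (R.adjoint ∘ₗ T) = ∑ l, inner ℝ (R (e l)) (T (e l)) := by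
    intro e
    rw [LinearMap.trace_eq_sum_inner _ e]
    refine Finset.sum_congr rfl fun l _ => ?_
    rw [LinearMap.comp_apply, LinearMap.adjoint_inner_right]
  have h1 : matInner X Z = LinearMap.trace ℝ _ (R.adjoint ∘ₗ T) := by
    rw [htr (EuclideanSpace.basisFun (Fin m₂) ℝ), matInner_eq, Finset.sum_comm]
    refine Finset.sum_congr rfl fun j _ => ?_
    simp [PiLp.inner_apply, hR, hT, Matrix.toLpLin_apply, mul_comm]
  rw [h1, htr b, traceNorm, Finset.mul_sum]
  refine Finset.sum_le_sum fun l _ => ?_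
  refine (real_inner_le_norm _ _).trans ?_
  rw [hnorm]
  refine mul_le_mul_of_nonneg_right ?_ (T.singularValues_nonneg _)
  simpa using norm_toEuclideanLin_le X (b l)

theorem dualNorm_traceNorm_le (X : Matrix (Fin m₁) (Fin m₂) ℝ) :
    dualNorm traceNorm X ≤ opNorm X :=
  dualNorm_le (by simp [traceNorm_zero]) fun Z hZ =>
    (matInner_le_opNorm_mul_traceNorm X Z).trans (mul_le_of_le_one_right (opNorm_nonneg X) hZ)

theorem matInner_smul (X Z : Matrix (Fin m₁) (Fin m₂) ℝ) (c : ℝ) :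
    matInner X (c • Z) = c * matInner X Z := by
  simp [matInner]

theorem matInner_add (X Y Z : Matrix (Fin m₁) (Fin m₂) ℝ) :
    matInner X (Y + Z) = matInner X Y + matInner X Z := by
  simp [matInner, Matrix.mul_add]

theorem dualNorm_kqTraceNorm_le {k q : ℕ} (hk : 1 ≤ k) (hkm : k ≤ m₁) (hq : 1 ≤ q)
    (hqm : q ≤ m₂) {X : Matrix (Fin m₁) (Fin m₂) ℝ} {c : ℝ} (hc : 0 ≤ c)
    (h : ∀ A ∈ kqAtoms m₁ m₂ k q, matInner X A ≤ c) : dualNorm (kqTraceNorm k q) X ≤ c := by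
  have hconv : ∀ Y ∈ convexHull ℝ (kqAtoms m₁ m₂ k q), matInner X Y ≤ c := by
    refine fun Y hY => convexHull_min (t := {Y | matInner X Y ≤ c}) h ?_ hY
    intro A hA B hB s t hs ht hst
    simp only [Set.mem_ofPred_eq, matInner_add, matInner_smul] at *
    calc s * matInner X A + t * matInner X B ≤ s * c + t * c := by gcongr
      _ = c := by rw [← add_mul, hst, one_mul]
  refine dualNorm_le (by simp [kqTraceNorm]) fun Z hZ => ?_
  refine le_of_forall_pos_le_add fun δ hδ => ?_
  obtain ⟨r, ⟨hr0, Y, hY, rfl⟩, hr2⟩ := exists_lt_of_csInf_lt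
    (absorbent_convexHull_kqAtoms hk hkm hq hqm Z)
    (lt_of_le_of_lt hZ (lt_add_of_pos_right 1 (by positivity : 0 < δ / (c + 1))))
  simp only [matInner_smul]
  calc r * matInner X Y ≤ r * c := mul_le_mul_of_nonneg_left (hconv Y hY) hr0.le
    _ ≤ (1 + δ / (c + 1)) * c := by gcongr
    _ = c + δ * (c / (c + 1)) := by ring
    _ ≤ c + δ := by
        have := mul_le_of_le_one_right hδ.le (div_le_one_of_le₀ (by linarith : c ≤ c + 1)
          (by positivity))
        linarith

end DualNorm

/-! ### Expected operator norm and expected dual of the `(k,q)`-trace norm -/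

theorem integrable_gaussianReal_iff {f : ℝ → ℝ} :
    Integrable f (gaussianReal 0 1) ↔
      Integrable (fun x => (√(2 * Real.pi))⁻¹ * Real.exp (-x ^ 2 / 2) * f x) := by
  rw [gaussianReal_of_var_ne_zero _ one_ne_zero, integrable_withDensity_iff_integrable_smul'
    (measurable_gaussianPDF _ _) (ae_of_all _ fun _ => gaussianPDF_lt_top)]
  simp [toReal_gaussianPDF, gaussianPDFReal_zero_one]

theorem integral_gaussianReal_eq (f : ℝ → ℝ) :
    ∫ x, f x ∂(gaussianReal 0 1) =
      ∫ x, (√(2 * Real.pi))⁻¹ * Real.exp (-x ^ 2 / 2) * f x := by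
  rw [integral_gaussianReal_eq_integral_smul one_ne_zero]
  simp [gaussianPDFReal_zero_one]

theorem integrable_exp_sq_div_four_gaussianReal :
    Integrable (fun x : ℝ => Real.exp (x ^ 2 / 4)) (gaussianReal 0 1) := by
  rw [integrable_gaussianReal_iff]
  refine ((integrable_exp_neg_mul_sq (b := 1 / 4) (by norm_num)).const_mul
    (√(2 * Real.pi))⁻¹).congr (ae_of_all _ fun x => ?_)
  simp only [mul_assoc, ← Real.exp_add]
  ring_nf

theorem integral_exp_sq_div_four_gaussianReal :
    ∫ x, Real.exp (x ^ 2 / 4) ∂(gaussianReal 0 1) = √2 := by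
  rw [integral_gaussianReal_eq]
  calc ∫ x : ℝ, (√(2 * Real.pi))⁻¹ * Real.exp (-x ^ 2 / 2) * Real.exp (x ^ 2 / 4)
      = ∫ x : ℝ, (√(2 * Real.pi))⁻¹ * Real.exp (-(1 / 4) * x ^ 2) := by
        congr 1; ext x
        rw [mul_assoc, ← Real.exp_add]
        ring_nf
    _ = √2 := by
        rw [integral_const_mul, integral_gaussian, ← Real.sqrt_inv, ← Real.sqrt_mul (by positivity)]
        congr 1
        field_simp
        norm_num

/-- Jensen's inequality for the square root, through `2 √(W M) ≤ W + M`. -/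
theorem integral_sqrt_le {α : Type*} [MeasurableSpace α] {μ : Measure α} [IsProbabilityMeasure μ]
    {W : α → ℝ} (hW : Integrable W μ) (hW0 : ∀ x, 0 ≤ W x) {M : ℝ} (hM : 0 < M)
    (hWM : ∫ x, W x ∂μ ≤ M) :
    Integrable (fun x => √(W x)) μ ∧ ∫ x, √(W x) ∂μ ≤ √M := by
  have hs : 0 < √M := Real.sqrt_pos.2 hM
  have hb : ∀ x, √(W x) ≤ (2 * √M)⁻¹ * W x + √M / 2 := by
    intro x
    have h1 : W x = √(W x) ^ 2 := (Real.sq_sqrt (hW0 x)).symm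
    have h2 : (2 * √M)⁻¹ * W x + √M / 2 - √(W x) = (√(W x) - √M) ^ 2 / (2 * √M) := by
      nth_rw 1 [h1]; field_simp; ring
    have h3 : 0 ≤ (√(W x) - √M) ^ 2 / (2 * √M) := by positivity
    linarith
  have hbi : Integrable (fun x => (2 * √M)⁻¹ * W x + √M / 2) μ :=
    (hW.const_mul _).add (integrable_const _)
  have hi : Integrable (fun x => √(W x)) μ := hbi.mono'
    (Real.continuous_sqrt.comp_aestronglyMeasurable hW.1)
    (ae_of_all _ fun x => by rw [Real.norm_of_nonneg (Real.sqrt_nonneg _)]; exact hb x)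
  refine ⟨hi, (integral_mono hi hbi hb).trans ?_⟩
  rw [integral_add (hW.const_mul _) (integrable_const _), integral_const_mul]
  simp only [integral_const, probReal_univ, one_smul]
  calc (2 * √M)⁻¹ * ∫ x, W x ∂μ + √M / 2 ≤ (2 * √M)⁻¹ * M + √M / 2 := by gcongr
    _ = √M := by
        nth_rw 2 [← Real.sq_sqrt hM.le]
        field_simp; ring

theorem sum_mul_le_sqrt_sum_sq {n : ℕ} {a : EuclideanSpace ℝ (Fin n)} (ha : ‖a‖ = 1)
    (g : Fin n → ℝ) (S : Finset (Fin n)) : ∑ i ∈ S, a i * g i ≤ √(∑ i ∈ S, g i ^ 2) := by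
  refine (Real.sum_mul_le_sqrt_mul_sqrt S (fun i => a i) g).trans ?_
  refine mul_le_of_le_one_left (Real.sqrt_nonneg _) ?_
  rw [← ha, EuclideanSpace.norm_eq]
  refine Real.sqrt_le_sqrt ?_
  simp only [Real.norm_eq_abs, sq_abs]
  exact Finset.sum_le_sum_of_subset_of_nonneg (Finset.subset_univ S) fun _ _ _ => sq_nonneg _

theorem integrable_comp_eval_gaussianPi {J : Type*} [Fintype J] (j : J) {f : ℝ → ℝ}
    (hf : Integrable f (gaussianReal 0 1)) :
    Integrable (fun z : J → ℝ => f (z j)) (gaussianPi J) :=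
  (measurePreserving_eval_gaussianPi j).hasLaw.integrable_comp hf

theorem integral_comp_eval_gaussianPi {J : Type*} [Fintype J] (j : J) {f : ℝ → ℝ}
    (hf : Integrable f (gaussianReal 0 1)) :
    ∫ z : J → ℝ, f (z j) ∂(gaussianPi J) = ∫ x, f x ∂(gaussianReal 0 1) :=
  (measurePreserving_eval_gaussianPi j).hasLaw.integral_comp hf.1

theorem integral_sqrt_sum_sq_gaussianPi_le {n : ℕ} (hn : 0 < n) :
    Integrable (fun g : Fin n → ℝ => √(∑ i, g i ^ 2)) (gaussianPi (Fin n)) ∧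
      ∫ g, √(∑ i, g i ^ 2) ∂(gaussianPi (Fin n)) ≤ √n := by
  have hi : ∀ i : Fin n, Integrable (fun g : Fin n → ℝ => g i ^ 2) (gaussianPi (Fin n)) :=
    fun i => integrable_comp_eval_gaussianPi i integrable_sq_gaussianReal
  refine integral_sqrt_le (integrable_finsetSum _ fun i _ => hi i) (fun g => by positivity)
    (by positivity) ?_
  rw [integral_finsetSum _ fun i _ => hi i]
  simp [integral_comp_eval_gaussianPi _ integrable_sq_gaussianReal, integral_sq_gaussianReal]

/-- A bound, uniform over `j`-sparse unit vectors `a`, for the square of `⟨a, g⟩`. With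
`t = 4 log (n / j)`, a sum of `j` squares is at most `j t + ∑ (g i ^ 2 - t)⁺`, and
`x⁺ ≤ 4 exp (x / 4)`. -/
noncomputable def sparseBound (n j : ℕ) (g : Fin n → ℝ) : ℝ :=
  j * (4 * Real.log ((n : ℝ) / j)) + ∑ i, 4 * ((j : ℝ) / n * Real.exp (g i ^ 2 / 4))

section SparseBound

variable {n j : ℕ}

theorem log_div_nonneg_of_le (hj : 1 ≤ j) (hjn : j ≤ n) : 0 ≤ Real.log ((n : ℝ) / j) := by
  refine Real.log_nonneg ?_
  rw [le_div_iff₀ (by positivity), one_mul]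
  exact_mod_cast hjn

theorem sparseBound_nonneg (hj : 1 ≤ j) (hjn : j ≤ n) (g : Fin n → ℝ) : 0 ≤ sparseBound n j g := by
  have := log_div_nonneg_of_le hj hjn
  unfold sparseBound
  positivity

theorem sum_mul_le_sqrt_sparseBound (hj : 1 ≤ j) (hjn : j ≤ n) {a : EuclideanSpace ℝ (Fin n)}
    (ha : a ∈ sparseUnitVectors n j) (g : Fin n → ℝ) :
    ∑ i, a i * g i ≤ √(sparseBound n j g) := by
  classical
  have hlog := log_div_nonneg_of_le hj hjn
  obtain ⟨hcard, hnorm⟩ := ha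
  set S : Finset (Fin n) := Finset.univ.filter fun i => a i ≠ 0 with hS
  have hSc : (S.card : ℝ) ≤ j := by
    have : {i | a i ≠ 0} = (S : Set (Fin n)) := by ext; simp [hS]
    rw [this, Set.ncard_coe_finset] at hcard
    exact_mod_cast hcard
  have hn0 : (0 : ℝ) < n := by exact_mod_cast (by omega : 0 < n)
  have hj0 : (0 : ℝ) < j := by exact_mod_cast (by omega : 0 < j)
  set t : ℝ := 4 * Real.log ((n : ℝ) / j) with ht
  have hexp : ∀ x : ℝ, x ^ 2 - t ≤ 4 * ((j : ℝ) / n * Real.exp (x ^ 2 / 4)) := by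
    intro x
    have h1 : (j : ℝ) / n * Real.exp (x ^ 2 / 4) = Real.exp ((x ^ 2 - t) / 4) := by
      have : (x ^ 2 - t) / 4 = -Real.log ((n : ℝ) / j) + x ^ 2 / 4 := by rw [ht]; ring
      rw [this, Real.exp_add, Real.exp_neg, Real.exp_log (by positivity), inv_div]
    rw [h1]
    have := Real.add_one_le_exp ((x ^ 2 - t) / 4)
    linarith
  calc ∑ i, a i * g i = ∑ i ∈ S, a i * g i := by
        rw [hS, Finset.sum_filter]
        refine Finset.sum_congr rfl fun i _ => ?_
        by_cases h : a i = 0 <;> simp [h]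
    _ ≤ √(∑ i ∈ S, g i ^ 2) := sum_mul_le_sqrt_sum_sq hnorm g S
    _ ≤ _ := by
        refine Real.sqrt_le_sqrt ?_
        calc ∑ i ∈ S, g i ^ 2
            ≤ ∑ i ∈ S, (t + 4 * ((j : ℝ) / n * Real.exp (g i ^ 2 / 4))) :=
              Finset.sum_le_sum fun i _ => by linarith [hexp (g i)]
          _ = S.card * t + ∑ i ∈ S, 4 * ((j : ℝ) / n * Real.exp (g i ^ 2 / 4)) := by
              rw [Finset.sum_add_distrib]; simp
          _ ≤ j * t + ∑ i, 4 * ((j : ℝ) / n * Real.exp (g i ^ 2 / 4)) := by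
              gcongr
              exact Finset.subset_univ S

theorem integral_sqrt_sparseBound_le (hj : 1 ≤ j) (hjn : j ≤ n) :
    Integrable (fun g => √(sparseBound n j g)) (gaussianPi (Fin n)) ∧
      ∫ g, √(sparseBound n j g) ∂(gaussianPi (Fin n)) ≤
        2 * √(j * Real.log ((n : ℝ) / j) + 2 * j) := by
  have hn0 : (0 : ℝ) < n := by exact_mod_cast (by omega : 0 < n)
  have hj0 : (0 : ℝ) < j := by exact_mod_cast (by omega : 0 < j)
  have hlog := log_div_nonneg_of_le hj hjn
  have hi : ∀ i : Fin n, Integrable (fun g : Fin n → ℝ =>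
      4 * ((j : ℝ) / n * Real.exp (g i ^ 2 / 4))) (gaussianPi (Fin n)) := fun i =>
    ((integrable_comp_eval_gaussianPi i integrable_exp_sq_div_four_gaussianReal).const_mul
      _).const_mul _
  have hsum := integrable_finsetSum Finset.univ fun i _ => hi i
  have e : 2 * √(j * Real.log ((n : ℝ) / j) + 2 * j) =
      √(4 * (j * Real.log ((n : ℝ) / j) + 2 * j)) := by
    rw [Real.sqrt_mul (by norm_num), show (4 : ℝ) = 2 ^ 2 by norm_num,
      Real.sqrt_sq (by norm_num)]
  rw [e]
  refine integral_sqrt_le (W := sparseBound n j) ((integrable_const _).add hsum) (sparseBound_nonneg hj hjn)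
    (by positivity) ?_
  unfold sparseBound
  rw [integral_add (integrable_const _) hsum, integral_finsetSum _ fun i _ => hi i]
  simp only [integral_const_mul, integral_comp_eval_gaussianPi _
    integrable_exp_sq_div_four_gaussianReal, integral_exp_sq_div_four_gaussianReal]
  simp only [integral_const, probReal_univ, one_smul, Finset.sum_const, Finset.card_univ,
    Fintype.card_fin, nsmul_eq_mul]
  have h2 : √2 ≤ 2 := by
    rw [Real.sqrt_le_left (by norm_num)]; norm_num
  have h3 : (n : ℝ) * (4 * (j / n * √2)) = 4 * j * √2 := by field_simp
  rw [h3]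
  nlinarith [mul_le_mul_of_nonneg_left h2 hj0.le]

end SparseBound

section Expectation

variable {Ω : Type*} [MeasurableSpace Ω] {P : Measure Ω} [IsProbabilityMeasure P] {m₁ m₂ : ℕ}
  {G : Ω → Matrix (Fin m₁) (Fin m₂) ℝ}

theorem nonneg_of_matInner_rankOne_le {X : Matrix (Fin m₁) (Fin m₂) ℝ} {c : ℝ}
    {a : EuclideanSpace ℝ (Fin m₁)} {b : EuclideanSpace ℝ (Fin m₂)}
    (h : matInner X (Matrix.of fun i j => a i * b j) ≤ c)
    (h' : matInner X (Matrix.of fun i j => (-a) i * b j) ≤ c) : 0 ≤ c := by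
  rw [← inner_toEuclideanLin] at h h'
  rw [inner_neg_left] at h'
  linarith

theorem integral_opNorm_le
    (hG : HasLaw (fun ω (p : Fin m₁ × Fin m₂) => G ω p.1 p.2) (gaussianPi (Fin m₁ × Fin m₂)) P)
    (hm₁ : 0 < m₁) (hm₂ : 0 < m₂) : ∫ ω, opNorm (G ω) ∂P ≤ √m₁ + √m₂ := by
  set s : Set (EuclideanSpace ℝ (Fin m₁) × EuclideanSpace ℝ (Fin m₂)) :=
    {x | ‖x.1‖ = 1 ∧ ‖x.2‖ = 1} with hs
  obtain ⟨a₀, ha₀⟩ : ∃ a : EuclideanSpace ℝ (Fin m₁), ‖a‖ = 1 :=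
    ⟨EuclideanSpace.single ⟨0, hm₁⟩ 1, by simp⟩
  obtain ⟨b₀, hb₀⟩ : ∃ b : EuclideanSpace ℝ (Fin m₂), ‖b‖ = 1 :=
    ⟨EuclideanSpace.single ⟨0, hm₂⟩ 1, by simp⟩
  obtain ⟨hU, hU'⟩ := integral_sqrt_sum_sq_gaussianPi_le hm₁
  obtain ⟨hV, hV'⟩ := integral_sqrt_sum_sq_gaussianPi_le hm₂
  refine (chevet hG (s := s) ⟨(a₀, b₀), ha₀, hb₀⟩ (fun x hx => hx) (integrable_opNorm hG) ?_ hU hV ?_ ?_).trans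
    (add_le_add hU' hV')
  · intro ω c hc
    refine opNorm_le ?_ fun a b ha hb => hc (a, b) ⟨ha, hb⟩
    exact nonneg_of_matInner_rankOne_le (hc (a₀, b₀) ⟨ha₀, hb₀⟩)
      (hc (-a₀, b₀) ⟨(norm_neg a₀).trans ha₀, hb₀⟩)
  · exact fun x hx g => sum_mul_le_sqrt_sum_sq hx.1 g _
  · exact fun x hx h => sum_mul_le_sqrt_sum_sq hx.2 h _

theorem single_mem_sparseUnitVectors {n j : ℕ} (hj : 1 ≤ j) (i : Fin n) :
    EuclideanSpace.single i 1 ∈ sparseUnitVectors n j := by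
  refine ⟨le_trans (Set.ncard_le_ncard (t := {i}) ?_) (by simpa using hj), by simp⟩
  intro x hx
  by_contra h
  simp_all

theorem neg_mem_sparseUnitVectors {n j : ℕ} {a : EuclideanSpace ℝ (Fin n)}
    (ha : a ∈ sparseUnitVectors n j) : -a ∈ sparseUnitVectors n j := by
  simpa [sparseUnitVectors] using ha

theorem kqTraceNorm_zero {k q : ℕ} : kqTraceNorm k q (0 : Matrix (Fin m₁) (Fin m₂) ℝ) = 0 := by
  simp [kqTraceNorm]

theorem integral_dualNorm_kqTraceNorm_le {k q : ℕ}
    (hG : HasLaw (fun ω (p : Fin m₁ × Fin m₂) => G ω p.1 p.2) (gaussianPi (Fin m₁ × Fin m₂)) P)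
    (hk : 1 ≤ k) (hkm : k ≤ m₁) (hq : 1 ≤ q) (hqm : q ≤ m₂) :
    ∫ ω, dualNorm (kqTraceNorm k q) (G ω) ∂P ≤
      2 * √(k * Real.log ((m₁ : ℝ) / k) + 2 * k) + 2 * √(q * Real.log ((m₂ : ℝ) / q) + 2 * q) := by
  have ha := single_mem_sparseUnitVectors hk (⟨0, by omega⟩ : Fin m₁)
  have hb := single_mem_sparseUnitVectors hq (⟨0, by omega⟩ : Fin m₂)
  obtain ⟨hU, hU'⟩ := integral_sqrt_sparseBound_le hk hkm
  obtain ⟨hV, hV'⟩ := integral_sqrt_sparseBound_le hq hqm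
  refine (chevet hG (s := sparseUnitVectors m₁ k ×ˢ sparseUnitVectors m₂ q) ⟨(_, _), ha, hb⟩
    (fun x hx => ⟨hx.1.2, hx.2.2⟩)
    (integrable_dualNorm hG (by simp [kqTraceNorm_zero]) (bddAbove_dual_kqTraceNorm hk hkm hq hqm))
    ?_ hU hV ?_ ?_).trans (add_le_add hU' hV')
  · intro ω c hc
    refine dualNorm_kqTraceNorm_le hk hkm hq hqm ?_ ?_
    · exact nonneg_of_matInner_rankOne_le (hc (_, _) ⟨ha, hb⟩)
        (hc (_, _) ⟨neg_mem_sparseUnitVectors ha, hb⟩)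
    · rintro A ⟨a, ha, b, hb, rfl⟩
      exact hc (a, b) ⟨ha, hb⟩
  · exact fun x hx g => sum_mul_le_sqrt_sparseBound hk hkm hx.1 g
  · exact fun x hx h => sum_mul_le_sqrt_sparseBound hq hqm hx.2 h

end Expectation

/-! ### The mean excess of a Gaussian variable over a level -/

theorem inv_sqrt_two_pi_mul_two : (√(2 * Real.pi))⁻¹ * 2 = √(2 / Real.pi) := by
  rw [eq_comm, Real.sqrt_eq_iff_mul_self_eq (by positivity) (by positivity)]
  have h := Real.mul_self_sqrt (show 0 ≤ 2 * Real.pi by positivity)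
  have h0 : √(2 * Real.pi) ≠ 0 := by positivity
  have hpi := Real.pi_ne_zero
  field_simp
  rw [sq, h]

theorem integral_comp_abs_gaussianReal (f : ℝ → ℝ) :
    ∫ x, f |x| ∂(gaussianReal 0 1) =
      √(2 / Real.pi) * ∫ x in Set.Ioi 0, f x * Real.exp (-x ^ 2 / 2) := by
  rw [integral_gaussianReal_eq]
  have h := integral_comp_abs
    (f := fun x => (√(2 * Real.pi))⁻¹ * Real.exp (-x ^ 2 / 2) * f x)
  simp only [sq_abs] at h
  calc ∫ x, (√(2 * Real.pi))⁻¹ * Real.exp (-x ^ 2 / 2) * f |x|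
      = 2 * ∫ x in Set.Ioi 0, (√(2 * Real.pi))⁻¹ * Real.exp (-x ^ 2 / 2) * f x := h
    _ = 2 * ((√(2 * Real.pi))⁻¹ * ∫ x in Set.Ioi 0, f x * Real.exp (-x ^ 2 / 2)) := by
        rw [← integral_const_mul, ← integral_const_mul, ← integral_const_mul]
        refine integral_congr_ae (ae_of_all _ fun x => ?_)
        simp only
        ring
    _ = _ := by rw [← inv_sqrt_two_pi_mul_two]; ring

theorem hasDerivAt_exp_neg_sq_div_two (x : ℝ) :
    HasDerivAt (fun x : ℝ => Real.exp (-x ^ 2 / 2)) (-x * Real.exp (-x ^ 2 / 2)) x := by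
  have h1 : HasDerivAt (fun x : ℝ => -x ^ 2 / 2) (-x) x :=
    (((hasDerivAt_pow 2 x).fun_neg).div_const 2).congr_deriv (by simp; ring)
  exact h1.exp.congr_deriv (by ring)

theorem tendsto_exp_neg_sq_div_two :
    Filter.Tendsto (fun x : ℝ => Real.exp (-x ^ 2 / 2)) Filter.atTop (nhds 0) := by
  refine Real.tendsto_exp_atBot.comp ?_
  have : (fun x : ℝ => -x ^ 2 / 2) = fun x => -(x ^ 2 * (1 / 2)) := by ext x; ring
  rw [this]
  exact Filter.tendsto_neg_atTop_atBot.comp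
    ((Filter.tendsto_pow_atTop two_ne_zero).atTop_mul_const (by norm_num))

theorem integrable_exp_neg_sq_div_two : Integrable fun x : ℝ => Real.exp (-x ^ 2 / 2) := by
  refine (integrable_exp_neg_mul_sq (b := 1 / 2) (by norm_num)).congr (ae_of_all _ fun x => ?_)
  simp only; congr 1; ring

theorem integrable_mul_exp_neg_sq_div_two :
    Integrable fun x : ℝ => x * Real.exp (-x ^ 2 / 2) := by
  refine (integrable_mul_exp_neg_mul_sq (b := 1 / 2) (by norm_num)).congr
    (ae_of_all _ fun x => ?_)
  simp only; congr 2; ring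

theorem integral_Ioi_exp_neg_sq_div_two :
    √(2 / Real.pi) * ∫ x in Set.Ioi (0 : ℝ), Real.exp (-x ^ 2 / 2) = 1 := by
  simpa using (integral_comp_abs_gaussianReal fun _ => 1).symm

theorem integral_Ioi_mul_exp_neg_sq_div_two :
    ∫ x in Set.Ioi (0 : ℝ), x * Real.exp (-x ^ 2 / 2) = 1 := by
  have h := integral_Ioi_of_hasDerivAt_of_tendsto' (a := 0) (m := 0)
    (f := fun x : ℝ => -Real.exp (-x ^ 2 / 2)) (f' := fun x => x * Real.exp (-x ^ 2 / 2))
    (fun x _ => (hasDerivAt_exp_neg_sq_div_two x).fun_neg.congr_deriv (by ring))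
    integrable_mul_exp_neg_sq_div_two.integrableOn
    (by simpa using tendsto_exp_neg_sq_div_two.neg)
  simpa using h

theorem integral_abs_gaussianReal : ∫ x, |x| ∂(gaussianReal 0 1) = √(2 / Real.pi) := by
  rw [integral_comp_abs_gaussianReal fun x => x, integral_Ioi_mul_exp_neg_sq_div_two, mul_one]

theorem sqrt_two_div_pi_le : √(2 / Real.pi) ≤ 0.7979 := by
  rw [Real.sqrt_le_left (by norm_num), div_le_iff₀ Real.pi_pos]
  have := Real.pi_gt_d4
  norm_num at this ⊢
  linarith

/-- A Mills ratio estimate for the mean excess over `t`. The function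
`-(1 - t (x³ + 5x) / (x⁴ + 6x² + 3)) exp (-x² / 2)` of `x`, built from a convergent of the
continued fraction of the Mills ratio, has derivative at least `(x - t) exp (-x² / 2)`. -/
theorem integral_Ioi_sub_mul_exp_le {t : ℝ} (ht : 0 ≤ t) :
    ∫ x in Set.Ioi t, (x - t) * Real.exp (-x ^ 2 / 2) ≤
      Real.exp (-t ^ 2 / 2) * ((t ^ 2 + 3) / (t ^ 4 + 6 * t ^ 2 + 3)) := by
  set Ψ : ℝ → ℝ := fun x =>
    -((1 - t * ((x ^ 3 + 5 * x) / (x ^ 4 + 6 * x ^ 2 + 3))) * Real.exp (-x ^ 2 / 2)) with hΨ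
  set ψ : ℝ → ℝ := fun x =>
    (x - t + t * (24 / (x ^ 4 + 6 * x ^ 2 + 3) ^ 2)) * Real.exp (-x ^ 2 / 2) with hψ
  have hD : ∀ x : ℝ, 0 < x ^ 4 + 6 * x ^ 2 + 3 := fun x => by positivity
  have hderiv : ∀ x, HasDerivAt Ψ (ψ x) x := by
    intro x
    have h1 : HasDerivAt (fun x : ℝ => x ^ 3 + 5 * x) (3 * x ^ 2 + 5) x :=
      ((hasDerivAt_pow 3 x).add ((hasDerivAt_id x).const_mul 5)).congr_deriv (by simp)
    have h2 : HasDerivAt (fun x : ℝ => x ^ 4 + 6 * x ^ 2 + 3) (4 * x ^ 3 + 12 * x) x :=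
      (((hasDerivAt_pow 4 x).add ((hasDerivAt_pow 2 x).const_mul 6)).add_const 3).congr_deriv
        (by simp; ring)
    refine (((((h1.fun_div h2 (hD x).ne').const_mul t).const_sub 1).fun_mul
      (hasDerivAt_exp_neg_sq_div_two x)).fun_neg).congr_deriv ?_
    simp only [hψ]
    have := (hD x).ne'
    field_simp
    ring
  have hpos : ∀ x ∈ Set.Ioi t, (x - t) * Real.exp (-x ^ 2 / 2) ≤ ψ x := by
    intro x _
    have : 0 ≤ t * (24 / (x ^ 4 + 6 * x ^ 2 + 3) ^ 2) := by positivity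
    exact mul_le_mul_of_nonneg_right (by linarith) (Real.exp_nonneg _)
  have hnn : ∀ x ∈ Set.Ioi t, 0 ≤ ψ x := fun x hx =>
    (mul_nonneg (sub_nonneg.2 (le_of_lt hx)) (Real.exp_nonneg _)).trans (hpos x hx)
  have hlim : Filter.Tendsto Ψ Filter.atTop (nhds 0) := by
    refine squeeze_zero_norm' (a := fun x => (1 + t * 2) * Real.exp (-x ^ 2 / 2)) ?_
      (by simpa using tendsto_exp_neg_sq_div_two.const_mul (1 + t * 2))
    filter_upwards [Filter.eventually_ge_atTop 0] with x hx
    rw [hΨ, norm_neg, norm_mul, Real.norm_eq_abs, Real.norm_of_nonneg (Real.exp_nonneg _)]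
    have h1 : (x ^ 3 + 5 * x) / (x ^ 4 + 6 * x ^ 2 + 3) ≤ 2 := by
      rw [div_le_iff₀ (hD x)]
      nlinarith [sq_nonneg (x ^ 2 - x), sq_nonneg (x - 1), sq_nonneg x, pow_nonneg hx 3]
    have h2 : 0 ≤ (x ^ 3 + 5 * x) / (x ^ 4 + 6 * x ^ 2 + 3) := by positivity
    gcongr
    rw [abs_le]
    constructor <;> nlinarith [mul_le_mul_of_nonneg_left h1 ht, mul_nonneg ht h2]
  have hint := integrableOn_Ioi_deriv_of_nonneg' (fun x _ => hderiv x) hnn hlim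
  have hval := integral_Ioi_of_hasDerivAt_of_nonneg' (fun x _ => hderiv x) hnn hlim
  calc ∫ x in Set.Ioi t, (x - t) * Real.exp (-x ^ 2 / 2) ≤ ∫ x in Set.Ioi t, ψ x := by
        refine setIntegral_mono_on ?_ hint measurableSet_Ioi hpos
        have : Integrable fun x : ℝ => (x - t) * Real.exp (-x ^ 2 / 2) := by
          simp only [sub_mul]
          exact integrable_mul_exp_neg_sq_div_two.sub
            (integrable_exp_neg_sq_div_two.const_mul t)
        exact this.integrableOn
    _ = _ := by
        rw [hval, hΨ]
        have := (hD t).ne'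
        field_simp
        ring

theorem integral_excess_gaussianReal_le {t : ℝ} (ht : 0 ≤ t) :
    ∫ x, max (|x| - t) 0 ∂(gaussianReal 0 1) ≤ √(2 / Real.pi) *
      (Real.exp (-t ^ 2 / 2) * ((t ^ 2 + 3) / (t ^ 4 + 6 * t ^ 2 + 3))) := by
  rw [integral_comp_abs_gaussianReal fun x => max (x - t) 0]
  refine mul_le_mul_of_nonneg_left (le_trans (le_of_eq ?_) (integral_Ioi_sub_mul_exp_le ht))
    (Real.sqrt_nonneg _)
  rw [← integral_indicator measurableSet_Ioi, ← integral_indicator measurableSet_Ioi]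
  congr 1
  ext x
  simp only [Set.indicator_apply, Set.mem_Ioi]
  split_ifs with h1 h2 h2
  · rw [max_eq_left (by linarith)]
  · rw [max_eq_right (by linarith), zero_mul]
  · linarith
  · rfl

/-- The coefficient `5 / 96` instead of `1 / 24` absorbs the remainder term. -/
theorem exp_neg_le_taylor {y : ℝ} (hy : 0 ≤ y) (hy1 : y ≤ 1) :
    Real.exp (-y) ≤ 1 - y + y ^ 2 / 2 - y ^ 3 / 6 + 5 / 96 * y ^ 4 := by
  have h := Real.exp_bound (x := -y) (by rwa [abs_neg, abs_of_nonneg hy]) (n := 4) (by norm_num)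
  rw [abs_neg, abs_of_nonneg hy] at h
  have h' := (abs_le.1 h).2
  simp only [Finset.sum_range_succ, Finset.sum_range_zero, Nat.factorial] at h'
  norm_num at h'
  linarith

/-- For the small level `6 / 5` the excess is computed from `(x - t)⁺ = x - t + (t - x)⁺` and the
Taylor expansion of the density, which is sharper there than the Mills ratio. -/
theorem integral_excess_six_fifths_gaussianReal_le :
    ∫ x, max (|x| - 6 / 5) 0 ∂(gaussianReal 0 1) ≤ 0.1125 := by
  rw [integral_comp_abs_gaussianReal fun x => max (x - 6 / 5) 0]
  have i1 := integrable_mul_exp_neg_sq_div_two.integrableOn (s := Set.Ioi (0 : ℝ))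
  have i2 := (integrable_exp_neg_sq_div_two.const_mul (6 / 5)).integrableOn
    (s := Set.Ioi (0 : ℝ))
  have i12 : IntegrableOn (fun x : ℝ => x * Real.exp (-x ^ 2 / 2) -
      6 / 5 * Real.exp (-x ^ 2 / 2)) (Set.Ioi (0 : ℝ)) := i1.sub i2
  have i3 : IntegrableOn (fun x : ℝ => (6 / 5 - x) * Real.exp (-x ^ 2 / 2))
      (Set.Ioc (0 : ℝ) (6 / 5)) := by
    have : Continuous fun x : ℝ => (6 / 5 - x) * Real.exp (-x ^ 2 / 2) := by fun_prop
    exact (this.integrableOn_Icc).mono_set Set.Ioc_subset_Icc_self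
  have i4 : Integrable ((Set.Ioc (0 : ℝ) (6 / 5)).indicator
      fun x : ℝ => (6 / 5 - x) * Real.exp (-x ^ 2 / 2)) :=
    (integrable_indicator_iff measurableSet_Ioc).2 i3
  have hsplit : ∫ x in Set.Ioi (0 : ℝ), max (x - 6 / 5) 0 * Real.exp (-x ^ 2 / 2) =
      1 - 6 / 5 * (∫ x in Set.Ioi (0 : ℝ), Real.exp (-x ^ 2 / 2)) +
        ∫ x in Set.Ioc (0 : ℝ) (6 / 5), (6 / 5 - x) * Real.exp (-x ^ 2 / 2) := by
    have h3 : ∫ x in Set.Ioc (0 : ℝ) (6 / 5), (6 / 5 - x) * Real.exp (-x ^ 2 / 2) =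
        ∫ x in Set.Ioi (0 : ℝ), (Set.Ioc (0 : ℝ) (6 / 5)).indicator
          (fun x : ℝ => (6 / 5 - x) * Real.exp (-x ^ 2 / 2)) x := by
      rw [setIntegral_indicator measurableSet_Ioc, Set.inter_eq_right.2 Set.Ioc_subset_Ioi_self]
    rw [h3, ← integral_Ioi_mul_exp_neg_sq_div_two, ← integral_const_mul, ← integral_sub i1 i2,
      ← integral_add i12 i4.integrableOn]
    refine setIntegral_congr_fun measurableSet_Ioi fun x hx => ?_
    rw [Set.mem_Ioi] at hx
    by_cases h : x ≤ 6 / 5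
    · simp only [Set.indicator_apply, Set.mem_Ioc, hx, h, true_and, if_true]
      rw [max_eq_right (by linarith)]
      ring
    · simp only [Set.indicator_apply, Set.mem_Ioc, hx, h, and_false, if_false]
      rw [max_eq_left (by linarith)]
      ring
  have htaylor : ∫ x in Set.Ioc (0 : ℝ) (6 / 5), (6 / 5 - x) * Real.exp (-x ^ 2 / 2) ≤ 0.6447 := by
    rw [← intervalIntegral.integral_of_le (by norm_num)]
    calc ∫ x in (0 : ℝ)..(6 / 5), (6 / 5 - x) * Real.exp (-x ^ 2 / 2)
        ≤ ∫ x in (0 : ℝ)..(6 / 5), (6 / 5 - x - 3 / 5 * x ^ 2 + 1 / 2 * x ^ 3 + 3 / 20 * x ^ 4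
            - 1 / 8 * x ^ 5 - 1 / 40 * x ^ 6 + 1 / 48 * x ^ 7 + 1 / 256 * x ^ 8
            - 5 / 1536 * x ^ 9) := by
          refine intervalIntegral.integral_mono_on (by norm_num)
            (Continuous.intervalIntegrable (by fun_prop) _ _)
            (Continuous.intervalIntegrable (by fun_prop) _ _) fun x hx => ?_
          have h := exp_neg_le_taylor (y := x ^ 2 / 2) (by positivity)
            (by nlinarith [hx.1, hx.2])
          rw [← neg_div] at h
          refine (mul_le_mul_of_nonneg_left h (sub_nonneg.2 hx.2)).trans (le_of_eq ?_)
          ring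
      _ ≤ 0.6447 := by
          have hd : ∀ x : ℝ, HasDerivAt (fun x : ℝ => 6 / 5 * x - x ^ 2 / 2 - 1 / 5 * x ^ 3
              + 1 / 8 * x ^ 4 + 3 / 100 * x ^ 5 - 1 / 48 * x ^ 6 - 1 / 280 * x ^ 7
              + 1 / 384 * x ^ 8 + 1 / 2304 * x ^ 9 - 1 / 3072 * x ^ 10)
              (6 / 5 - x - 3 / 5 * x ^ 2 + 1 / 2 * x ^ 3 + 3 / 20 * x ^ 4
            - 1 / 8 * x ^ 5 - 1 / 40 * x ^ 6 + 1 / 48 * x ^ 7 + 1 / 256 * x ^ 8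
            - 5 / 1536 * x ^ 9) x := by
            intro x
            have hq : ∀ (c : ℝ) (n : ℕ), HasDerivAt (fun x : ℝ => c * x ^ n)
              (c * (n * x ^ (n - 1))) x := fun c n => (hasDerivAt_pow n x).const_mul c
            exact ((((((((((hasDerivAt_id x).const_mul (6 / 5)).fun_sub
              ((hasDerivAt_pow 2 x).div_const 2)).fun_sub (hq (1 / 5) 3)).fun_add
              (hq (1 / 8) 4)).fun_add (hq (3 / 100) 5)).fun_sub (hq (1 / 48) 6)).fun_sub
              (hq (1 / 280) 7)).fun_add (hq (1 / 384) 8)).fun_add (hq (1 / 2304) 9)).fun_sub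
              (hq (1 / 3072) 10) |>.congr_deriv (by norm_num; ring)
          rw [intervalIntegral.integral_eq_sub_of_hasDerivAt (fun x _ => hd x)
            (Continuous.intervalIntegrable (by fun_prop) _ _)]
          norm_num
  have h1 := integral_Ioi_exp_neg_sq_div_two
  have hc := sqrt_two_div_pi_le
  have hc0 : 0 ≤ √(2 / Real.pi) := Real.sqrt_nonneg _
  rw [hsplit]
  calc √(2 / Real.pi) * (1 - 6 / 5 * (∫ x in Set.Ioi (0 : ℝ), Real.exp (-x ^ 2 / 2)) +
        ∫ x in Set.Ioc (0 : ℝ) (6 / 5), (6 / 5 - x) * Real.exp (-x ^ 2 / 2))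
      = √(2 / Real.pi) * (1 + ∫ x in Set.Ioc (0 : ℝ) (6 / 5),
          (6 / 5 - x) * Real.exp (-x ^ 2 / 2)) -
        6 / 5 * (√(2 / Real.pi) * ∫ x in Set.Ioi (0 : ℝ), Real.exp (-x ^ 2 / 2)) := by ring
    _ ≤ √(2 / Real.pi) * (1 + 0.6447) - 6 / 5 * 1 := by rw [h1]; gcongr
    _ ≤ 0.7979 * (1 + 0.6447) - 6 / 5 * 1 := by gcongr
    _ ≤ 0.1125 := by norm_num

/-! ### The expected maximum of absolute values of independent Gaussian variables -/

section MaxGaussian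

variable {Ω : Type*} [MeasurableSpace Ω] {P : Measure Ω}

theorem integrable_abs_of_hasLaw {X : Ω → ℝ} (hX : HasLaw X (gaussianReal 0 1) P) :
    Integrable (fun ω => |X ω|) P :=
  hX.integrable_comp (f := fun x => |x|) (((memLp_id_gaussianReal 1).integrable (by simp)).abs)

theorem integral_abs_of_hasLaw {X : Ω → ℝ} (hX : HasLaw X (gaussianReal 0 1) P) :
    ∫ ω, |X ω| ∂P = √(2 / Real.pi) := by
  rw [← integral_abs_gaussianReal]
  exact hX.integral_comp (f := fun x => |x|) (by fun_prop)

/-- For every level `t`, a maximum is at most `t` plus the sum of the excesses over `t`. -/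
theorem integral_le_add_card_mul_excess [IsProbabilityMeasure P] {ι : Type*} [Fintype ι]
    [Nonempty ι] {X : ι → Ω → ℝ} (hX : ∀ i, HasLaw (X i) (gaussianReal 0 1) P) {M : Ω → ℝ}
    (hM : Integrable M P) (hle : ∀ ω c, (∀ i, |X i ω| ≤ c) → M ω ≤ c) (t : ℝ) :
    ∫ ω, M ω ∂P ≤ t + Fintype.card ι * ∫ x, max (|x| - t) 0 ∂(gaussianReal 0 1) := by
  have hg : Integrable (fun x : ℝ => max (|x| - t) 0) (gaussianReal 0 1) :=
    ((((memLp_id_gaussianReal 1).integrable (by simp)).abs).sub (integrable_const t)).pos_part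
  have hi : ∀ i, Integrable (fun ω => max (|X i ω| - t) 0) P := fun i =>
    (hX i).integrable_comp hg
  have he : ∀ i, ∫ ω, max (|X i ω| - t) 0 ∂P = ∫ x, max (|x| - t) 0 ∂(gaussianReal 0 1) :=
    fun i => (hX i).integral_comp hg.1
  have hsum := integrable_finsetSum Finset.univ fun i _ => hi i
  calc ∫ ω, M ω ∂P ≤ ∫ ω, (t + ∑ i, max (|X i ω| - t) 0) ∂P := by
        refine integral_mono hM ((integrable_const t).add hsum) fun ω => hle ω _ fun i => ?_
        have h1 := Finset.single_le_sum (f := fun i => max (|X i ω| - t) 0)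
          (fun _ _ => le_max_right _ _) (Finset.mem_univ i)
        have h2 := le_max_left (|X i ω| - t) 0
        linarith
    _ = _ := by
        rw [integral_add (integrable_const t) hsum, integral_finsetSum _ fun i _ => hi i]
        simp [he]

theorem max_abs_abs_eq (x y : ℝ) : max |x| |y| = (|x + y| + |x - y|) / 2 := by
  have hx := le_max_left |x| |y|
  have hy := le_max_right |x| |y|
  refine le_antisymm (max_le ?_ ?_) ?_
  · have h := abs_add_le (x + y) (x - y)
    rw [show x + y + (x - y) = 2 * x by ring, abs_mul, abs_two] at h
    linarith
  · have h := abs_sub (x + y) (x - y)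
    rw [show x + y - (x - y) = 2 * y by ring, abs_mul, abs_two] at h
    linarith
  · have := le_abs_self x
    have := neg_le_abs x
    have := le_abs_self y
    have := neg_le_abs y
    rcases abs_cases (x + y) with ⟨h1, -⟩ | ⟨h1, -⟩ <;>
      rcases abs_cases (x - y) with ⟨h2, -⟩ | ⟨h2, -⟩ <;> rw [h1, h2] <;> linarith

/-- The maximum of `|X|` and `|Y|` is `(|X + Y| + |X - Y|) / 2`, and `X ± Y` are Gaussian. -/
theorem integral_max_abs_of_indepFun {X Y : Ω → ℝ}
    (hX : HasLaw X (gaussianReal 0 1) P) (hY : HasLaw Y (gaussianReal 0 1) P)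
    (hXY : IndepFun X Y P) :
    Integrable (fun ω => max |X ω| |Y ω|) P ∧
      ∫ ω, max |X ω| |Y ω| ∂P = √2 * √(2 / Real.pi) := by
  have key : ∀ Y : Ω → ℝ, HasLaw Y (gaussianReal 0 1) P → IndepFun X Y P →
      HasLaw (fun ω => (√2)⁻¹ * (X ω + Y ω)) (gaussianReal 0 1) P := by
    intro Y hY hXY
    have h : HasLaw (X + Y) (gaussianReal (0 + 0) (1 + 1)) P :=
      ⟨hX.aemeasurable.add hY.aemeasurable,
        gaussianReal_add_gaussianReal_of_indepFun hXY hX.map_eq hY.map_eq⟩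
    have h2 := gaussianReal_const_mul h (√2)⁻¹
    convert h2 using 2
    · simp
    · simp
    · refine NNReal.eq ?_
      simp only [NNReal.coe_mul, NNReal.coe_mk, NNReal.coe_add, NNReal.coe_one]
      rw [inv_pow, Real.sq_sqrt (by norm_num)]
      norm_num
  have h1 := key Y hY hXY
  have h2 := key (-Y) (by simpa using gaussianReal_neg hY)
    (hXY.comp measurable_id measurable_neg)
  have hmax : ∀ ω, max |X ω| |Y ω| =
      √2 / 2 * (|(√2)⁻¹ * (X ω + Y ω)| + |(√2)⁻¹ * (X ω + (-Y) ω)|) := by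
    intro ω
    have h0 : (0 : ℝ) < √2 := by positivity
    rw [abs_mul, abs_mul, abs_of_pos (inv_pos.2 h0)]
    have e : √2 / 2 * ((√2)⁻¹ * |X ω + Y ω| + (√2)⁻¹ * |X ω + (-Y) ω|) =
        (|X ω + Y ω| + |X ω - Y ω|) / 2 := by
      rw [Pi.neg_apply, ← sub_eq_add_neg]
      field_simp
    rw [e, max_abs_abs_eq]
  simp only [hmax]
  have i1 := integrable_abs_of_hasLaw h1
  have i2 := integrable_abs_of_hasLaw h2
  refine ⟨(i1.add i2).const_mul _, ?_⟩
  rw [integral_const_mul, integral_add i1 i2, integral_abs_of_hasLaw h1,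
    integral_abs_of_hasLaw h2]
  ring

theorem log_three_gt : 1.0891 < Real.log 3 := by
  have h : Real.log (2 ^ 11) ≤ Real.log (3 ^ 7) := Real.log_le_log (by norm_num) (by norm_num)
  rw [Real.log_pow, Real.log_pow] at h
  have := Real.log_two_gt_d9
  push_cast at h
  norm_num at *
  linarith

theorem log_five_gt : 1.559 < Real.log 5 := by
  have h : Real.log (2 ^ 9) ≤ Real.log (5 ^ 4) := Real.log_le_log (by norm_num) (by norm_num)
  rw [Real.log_pow, Real.log_pow] at h
  have := Real.log_two_gt_d9
  push_cast at h
  norm_num at *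
  linarith

theorem log_six_gt : 1.782 < Real.log 6 := by
  have h : Real.log 6 = Real.log 2 + Real.log 3 := by
    rw [← Real.log_mul (by norm_num) (by norm_num)]; norm_num
  have := Real.log_two_gt_d9
  have := log_three_gt
  norm_num at *
  linarith

theorem log_seven_gt : 1.9407 < Real.log 7 := by
  have h : Real.log (2 ^ 14) ≤ Real.log (7 ^ 5) := Real.log_le_log (by norm_num) (by norm_num)
  rw [Real.log_pow, Real.log_pow] at h
  have := Real.log_two_gt_d9
  push_cast at h
  norm_num at *
  linarith

theorem integral_max_le_of_card_eq_two {X Y : Ω → ℝ}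
    (hX : HasLaw X (gaussianReal 0 1) P) (hY : HasLaw Y (gaussianReal 0 1) P)
    (hXY : IndepFun X Y P) {M : Ω → ℝ} (hM : Integrable M P)
    (hle : ∀ ω, M ω ≤ max |X ω| |Y ω|) : ∫ ω, M ω ∂P ≤ √(2 * Real.log 2) := by
  obtain ⟨hi, he⟩ := integral_max_abs_of_indepFun hX hY hXY
  refine (integral_mono hM hi hle).trans ?_
  rw [he]
  refine Real.le_sqrt_of_sq_le ?_
  have h1 := sqrt_two_div_pi_le
  have h2 := Real.log_two_gt_d9
  rw [mul_pow, Real.sq_sqrt (by norm_num)]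
  have h3 : √(2 / Real.pi) ^ 2 ≤ 0.7979 ^ 2 := by gcongr
  norm_num at *
  linarith

/-- For `x ≥ y ≥ z ≥ 0`, two thirds of the sum of the pairwise maxima minus a third of `x + y + z`
is `x + (y - z) / 3 ≥ x`. -/
theorem le_pairwise_max {x y z : ℝ} : max x (max y z) ≤
    2 / 3 * (max x y + max y z + max z x) - 1 / 3 * (x + y + z) := by
  rcases le_total x y with h1 | h1 <;> rcases le_total y z with h2 | h2 <;>
    rcases le_total z x with h3 | h3 <;> simp [h1, h2, h3] <;> linarith

theorem integral_max_le_of_card_eq_three {X Y Z : Ω → ℝ}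
    (hX : HasLaw X (gaussianReal 0 1) P) (hY : HasLaw Y (gaussianReal 0 1) P)
    (hZ : HasLaw Z (gaussianReal 0 1) P) (hXY : IndepFun X Y P) (hYZ : IndepFun Y Z P)
    (hZX : IndepFun Z X P) {M : Ω → ℝ} (hM : Integrable M P)
    (hle : ∀ ω, M ω ≤ max |X ω| (max |Y ω| |Z ω|)) : ∫ ω, M ω ∂P ≤ √(2 * Real.log 3) := by
  obtain ⟨i1, e1⟩ := integral_max_abs_of_indepFun hX hY hXY
  obtain ⟨i2, e2⟩ := integral_max_abs_of_indepFun hY hZ hYZ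
  obtain ⟨i3, e3⟩ := integral_max_abs_of_indepFun hZ hX hZX
  have j1 := integrable_abs_of_hasLaw hX
  have j2 := integrable_abs_of_hasLaw hY
  have j3 := integrable_abs_of_hasLaw hZ
  have i12 : Integrable (fun ω => max |X ω| |Y ω| + max |Y ω| |Z ω|) P := i1.add i2
  have i123 : Integrable
      (fun ω => max |X ω| |Y ω| + max |Y ω| |Z ω| + max |Z ω| |X ω|) P := i12.add i3
  have j12 : Integrable (fun ω => |X ω| + |Y ω|) P := j1.add j2
  have j123 : Integrable (fun ω => |X ω| + |Y ω| + |Z ω|) P := j12.add j3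
  refine (integral_mono hM ((i123.const_mul (2 / 3)).sub (j123.const_mul (1 / 3)))
    fun ω => (hle ω).trans le_pairwise_max).trans ?_
  simp only [Pi.sub_apply]
  rw [integral_sub (i123.const_mul (2 / 3)) (j123.const_mul (1 / 3)), integral_const_mul,
    integral_const_mul, integral_add i12 i3, integral_add i1 i2, integral_add j12 j3,
    integral_add j1 j2, e1, e2, e3, integral_abs_of_hasLaw hX, integral_abs_of_hasLaw hY,
    integral_abs_of_hasLaw hZ]
  have h1 := sqrt_two_div_pi_le
  have h0 : 0 ≤ √(2 / Real.pi) := Real.sqrt_nonneg _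
  have h2 : √2 ≤ 1.4143 := by rw [Real.sqrt_le_left (by norm_num)]; norm_num
  have h3 : 1 ≤ √2 := Real.one_le_sqrt.2 (by norm_num)
  have h4 := log_three_gt
  refine Real.le_sqrt_of_sq_le ?_
  calc _ = (√(2 / Real.pi) * (2 * √2 - 1)) ^ 2 := by ring
    _ ≤ (0.7979 * (2 * 1.4143 - 1)) ^ 2 := by
        have : 0 ≤ 2 * √2 - 1 := by linarith
        gcongr
    _ ≤ 2 * Real.log 3 := by norm_num at *; linarith

theorem exp_085_le : Real.exp 0.85 ≤ 2.34 := by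
  have h := Real.exp_one_lt_d9
  have h2 := exp_neg_le_taylor (y := 0.15) (by norm_num) (by norm_num)
  have h3 : Real.exp 0.85 = Real.exp 1 * Real.exp (-0.15) := by
    rw [← Real.exp_add]; norm_num
  rw [h3]
  calc Real.exp 1 * Real.exp (-0.15) ≤ 2.7182818286 * Real.exp (-0.15) := by gcongr
    _ ≤ 2.7182818286 * (1 - 0.15 + 0.15 ^ 2 / 2 - 0.15 ^ 3 / 6 + 5 / 96 * 0.15 ^ 4) := by gcongr
    _ ≤ 2.34 := by norm_num

/-- The Mills ratio estimate at the level `t` with `t² = 2 log N - 1.7`, which is close to the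
optimal one. -/
theorem mills_bound_le_sqrt {N : ℕ} (hN : 7 ≤ N) :
    ∃ t, 0 ≤ t ∧ t + N * (√(2 / Real.pi) *
      (Real.exp (-t ^ 2 / 2) * ((t ^ 2 + 3) / (t ^ 4 + 6 * t ^ 2 + 3)))) ≤
        √(2 * Real.log N) := by
  have hN0 : (0 : ℝ) < N := by positivity
  have hlog : 1.9407 < Real.log N :=
    log_seven_gt.trans_le (Real.log_le_log (by norm_num) (by exact_mod_cast hN))
  norm_num at hlog
  set L := √(2 * Real.log N) with hL
  set t := √(2 * Real.log N - 1.7) with ht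
  have hL2 : L ^ 2 = 2 * Real.log N := Real.sq_sqrt (by linarith)
  have ht2 : t ^ 2 = 2 * Real.log N - 1.7 := Real.sq_sqrt (by norm_num; linarith)
  have hL0 : 0 ≤ L := Real.sqrt_nonneg _
  have ht0 : 0 ≤ t := Real.sqrt_nonneg _
  have hLt : L ^ 2 = t ^ 2 + 1.7 := by rw [hL2, ht2]; ring
  have hS : 2.181 ≤ t ^ 2 := by rw [ht2]; norm_num; linarith
  refine ⟨t, ht0, ?_⟩
  have hexp : N * Real.exp (-t ^ 2 / 2) = Real.exp 0.85 := by
    have : -t ^ 2 / 2 = -Real.log N + 0.85 := by rw [ht2]; ring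
    rw [this, Real.exp_add, Real.exp_neg, Real.exp_log hN0, mul_inv_cancel_left₀ hN0.ne']
  have hA : √(2 / Real.pi) * Real.exp 0.85 ≤ 1.868 := by
    calc √(2 / Real.pi) * Real.exp 0.85 ≤ 0.7979 * 2.34 := by
          gcongr
          · exact sqrt_two_div_pi_le
          · exact exp_085_le
      _ ≤ 1.868 := by norm_num
  have hD : 0 < t ^ 4 + 6 * t ^ 2 + 3 := by positivity
  -- `L - t = 1.7 / (L + t)`, and `L + t` is bounded by its tangents at `L = 2` and `t = 3 / 2`.
  have hsum : L + t ≤ (7 * t ^ 2 + 26.1) / 12 := by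
    nlinarith [sq_nonneg (L - 2), sq_nonneg (t - 3 / 2)]
  have hpos : 0 < L + t := by
    have : 0 < L ^ 2 := by rw [hLt]; positivity
    have : L ≠ 0 := by rintro h; simp [h] at this
    positivity
  have hdiff : L - t = 1.7 / (L + t) := by
    rw [eq_div_iff hpos.ne']
    linear_combination hLt
  have hmain : 1.868 * ((t ^ 2 + 3) / (t ^ 4 + 6 * t ^ 2 + 3)) ≤ L - t := by
    rw [hdiff, ← mul_div_assoc, div_le_div_iff₀ hD hpos]
    calc 1.868 * (t ^ 2 + 3) * (L + t) ≤ 1.868 * (t ^ 2 + 3) * ((7 * t ^ 2 + 26.1) / 12) := by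
          gcongr
      _ ≤ 1.7 * (t ^ 4 + 6 * t ^ 2 + 3) := by nlinarith
  calc t + N * (√(2 / Real.pi) *
        (Real.exp (-t ^ 2 / 2) * ((t ^ 2 + 3) / (t ^ 4 + 6 * t ^ 2 + 3))))
      = t + √(2 / Real.pi) * (N * Real.exp (-t ^ 2 / 2)) *
          ((t ^ 2 + 3) / (t ^ 4 + 6 * t ^ 2 + 3)) := by ring
    _ ≤ t + 1.868 * ((t ^ 2 + 3) / (t ^ 4 + 6 * t ^ 2 + 3)) := by
        rw [hexp]; gcongr
    _ ≤ L := by linarith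

/-- The bound `√(2 log N)` for the expected maximum of `N ≥ 2` absolute values. For `N ≥ 4` it
only uses the marginal laws; for `N = 2, 3` the marginal laws do not suffice, and independence
enters through the pairwise maxima. -/
theorem integral_max_abs_gaussian_le [IsProbabilityMeasure P] {ι : Type*} [Fintype ι]
    (hcard : 2 ≤ Fintype.card ι) {X : ι → Ω → ℝ} (hX : ∀ i, HasLaw (X i) (gaussianReal 0 1) P)
    (hind : iIndepFun X P) {M : Ω → ℝ} (hM : Integrable M P)
    (hle : ∀ ω c, (∀ i, |X i ω| ≤ c) → M ω ≤ c) :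
    ∫ ω, M ω ∂P ≤ √(2 * Real.log (Fintype.card ι)) := by
  classical
  have : Nonempty ι := Fintype.card_pos_iff.1 (by omega)
  rcases lt_or_ge (Fintype.card ι) 7 with h7 | h7
  · have hsmall := integral_le_add_card_mul_excess hX hM hle (6 / 5)
    have hex := integral_excess_six_fifths_gaussianReal_le
    set N := Fintype.card ι with hN
    have h4 : 4 ≤ N → (6 / 5 + N * 0.1125 : ℝ) ^ 2 ≤ 2 * Real.log N →
        ∫ ω, M ω ∂P ≤ √(2 * Real.log N) := by
      intro _ h
      refine hsmall.trans ((add_le_add_right (mul_le_mul_of_nonneg_left hex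
        (Nat.cast_nonneg N)) _).trans (Real.le_sqrt_of_sq_le h))
    have l2 := Real.log_two_gt_d9
    have l5 := log_five_gt
    have l6 := log_six_gt
    have l4 : Real.log 4 = 2 * Real.log 2 := by
      rw [show (4 : ℝ) = 2 ^ 2 by norm_num, Real.log_pow]; norm_num
    have hcases : N = 2 ∨ N = 3 ∨ N = 4 ∨ N = 5 ∨ N = 6 := by omega
    rcases hcases with h | h | h | h | h
    · obtain ⟨i, j, hij, huniv⟩ := Finset.card_eq_two.1 (Finset.card_univ.trans h)
      rw [h]
      refine integral_max_le_of_card_eq_two (hX i) (hX j) (hind.indepFun hij) hM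
        fun ω => hle ω _ fun l => ?_
      have hl : l ∈ ({i, j} : Finset ι) := huniv ▸ Finset.mem_univ l
      simp only [Finset.mem_insert, Finset.mem_singleton] at hl
      rcases hl with rfl | rfl <;> simp
    · obtain ⟨i, j, l, hij, hil, hjl, huniv⟩ :=
        Finset.card_eq_three.1 (Finset.card_univ.trans h)
      rw [h]
      refine integral_max_le_of_card_eq_three (hX i) (hX j) (hX l) (hind.indepFun hij)
        (hind.indepFun hjl) (hind.indepFun hil.symm) hM fun ω => hle ω _ fun n => ?_
      have hn : n ∈ ({i, j, l} : Finset ι) := huniv ▸ Finset.mem_univ n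
      simp only [Finset.mem_insert, Finset.mem_singleton] at hn
      rcases hn with rfl | rfl | rfl <;> simp
    all_goals
      refine h4 (by omega) ?_
      rw [h]
      norm_num at *
      linarith
  · obtain ⟨t, ht, hbound⟩ := mills_bound_le_sqrt h7
    refine (integral_le_add_card_mul_excess hX hM hle t).trans (le_trans ?_ hbound)
    gcongr
    exact integral_excess_gaussianReal_le ht

end MaxGaussian

theorem mainTheorem4 {Ω : Type*} [MeasurableSpace Ω] (P : Measure Ω) [IsProbabilityMeasure P]
    {m₁ m₂ k q : ℕ} (hk : 1 ≤ k) (hkm : k ≤ m₁) (hq : 1 ≤ q) (hqm : q ≤ m₂)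
    (G : Ω → Matrix (Fin m₁) (Fin m₂) ℝ)
    (hindep : iIndepFun (fun (p : Fin m₁ × Fin m₂) (ω : Ω) => G ω p.1 p.2) P)
    (hlaw : ∀ i j, HasLaw (fun ω => G ω i j) (gaussianReal 0 1) P) :
    -- the dual of the `(k,q)`-trace norm
    (Integrable (fun ω => dualNorm (kqTraceNorm k q) (G ω)) P ∧
      ∫ ω, dualNorm (kqTraceNorm k q) (G ω) ∂P
        ≤ 4 * (Real.sqrt (k * Real.log ((m₁ : ℝ) / k) + 2 * k)
              + Real.sqrt (q * Real.log ((m₂ : ℝ) / q) + 2 * q))) ∧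
    -- the dual of the `ℓ₁` norm, i.e. the entrywise maximum norm
    (Integrable (fun ω => dualNorm entryL1Norm (G ω)) P ∧
      Integrable (fun ω => entryMaxNorm (G ω)) P ∧
      (2 ≤ m₁ * m₂ →
        ∫ ω, dualNorm entryL1Norm (G ω) ∂P ≤ Real.sqrt (2 * Real.log ((m₁ : ℝ) * m₂)) ∧
        ∫ ω, entryMaxNorm (G ω) ∂P ≤ Real.sqrt (2 * Real.log ((m₁ : ℝ) * m₂)))) ∧
    -- the dual of the trace norm, i.e. the operator norm
    (Integrable (fun ω => dualNorm traceNorm (G ω)) P ∧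
      Integrable (fun ω => opNorm (G ω)) P ∧
      ∫ ω, dualNorm traceNorm (G ω) ∂P ≤ Real.sqrt m₁ + Real.sqrt m₂ ∧
      ∫ ω, opNorm (G ω) ∂P ≤ Real.sqrt m₁ + Real.sqrt m₂) := by
  have hG : HasLaw (fun ω (p : Fin m₁ × Fin m₂) => G ω p.1 p.2)
      (gaussianPi (Fin m₁ × Fin m₂)) P := hindep.hasLaw_pi fun p => hlaw p.1 p.2
  have hm₁ : 0 < m₁ := by omega
  have hm₂ : 0 < m₂ := by omega
  have : Nonempty (Fin m₁ × Fin m₂) := ⟨(⟨0, hm₁⟩, ⟨0, hm₂⟩)⟩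
  have iL1 : Integrable (fun ω => dualNorm entryL1Norm (G ω)) P :=
    integrable_dualNorm hG (by simp [entryL1Norm_zero]) bddAbove_dual_entryL1Norm
  have iMax := integrable_entryMaxNorm hG
  have iTr : Integrable (fun ω => dualNorm traceNorm (G ω)) P :=
    integrable_dualNorm hG (by simp [traceNorm_zero]) bddAbove_dual_traceNorm
  have iOp := integrable_opNorm hG
  have hOp := integral_opNorm_le hG hm₁ hm₂
  refine ⟨⟨integrable_dualNorm hG (by simp [kqTraceNorm_zero])
    (bddAbove_dual_kqTraceNorm hk hkm hq hqm), ?_⟩, ⟨iL1, iMax, fun h2 => ?_⟩, iTr, iOp, ?_, hOp⟩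
  · refine (integral_dualNorm_kqTraceNorm_le hG hk hkm hq hqm).trans ?_
    have := Real.sqrt_nonneg (k * Real.log ((m₁ : ℝ) / k) + 2 * k)
    have := Real.sqrt_nonneg (q * Real.log ((m₂ : ℝ) / q) + 2 * q)
    linarith
  · have hMax : ∫ ω, entryMaxNorm (G ω) ∂P ≤ √(2 * Real.log ((m₁ : ℝ) * m₂)) := by
      have h := integral_max_abs_gaussian_le (ι := Fin m₁ × Fin m₂) (by simpa using h2)
        (fun p => hlaw p.1 p.2) hindep iMax fun ω c hc => ciSup_le hc
      simpa using h
    exact ⟨(integral_mono iL1 iMax fun ω => dualNorm_entryL1Norm_le (G ω)).trans hMax, hMax⟩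
  · exact (integral_mono iTr iOp fun ω => dualNorm_traceNorm_le (G ω)).trans hOp
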